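/- **Setting.** Consider the two-stage stochastic linear program $$\min_x\ \mathcal Q(x)=c^Tx+\sum_{i=1}^N p_i\mathcal Q_i(x)\quad\text{subject to } Ax=b,\ x\ge 0,$$ $$\mathcal Q_i(x)=\min_y\{q_i^Ty : Wy=h_i-T_ix,\ y\ge 0\},$$ where $x\in\mathbb R^n$, $p_i\ge 0$, $\sum_i p_i=1$. Assume that for all $i$ and all $x\in\mathbb R^n$ the second-stage problem is feasible and bounded below, and that the solution set $\mathcal S$ is nonempty. The scenarios are partitioned into $T$ clusters $\mathcal N_1,\dots,\mathcal N_T$, and $\mathcal Q_{[j]}=\sum_{i\in\mathcal N_j}p_i\mathcal Q_i$. Let $P(x)$ denote the Euclidean projection of $x$ onto $\mathcal S$. **Algorithm ATR.** Parameters: $\xi\in(0,1/2)$, $\eta\in[0,1)$, $\sigma\in(0,1]$, $\epsilon_{\rm tol}\ge 0$, $\Delta_{\rm hi}>0$, an integer $K>0$, an initial radius $\Delta_{\rm curr}\in(0,\Delta_{\rm hi}]$, and a starting point $x^0$ with $Ax^0=b$, $x^0\ge0$. *Model.* The model is $m(x)=c^Tx+\sum_j m_{[j]}(x)$, where $m_{[j]}$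 is the maximum of the stored cuts (affine minorants of $\mathcal Q_{[j]}$) of cluster $j$. The initial model is a finite, possibly empty, set of such cuts. *Initialization.* Set $k=0$, incumbent index $I=-1$, $x^{-1}=x^0$, $\mathcal Q^{-1}=\infty$, $I_0=-1$, $\mathcal B=\emptyset$, ${\tt counter}=0$, $t_0=0$, ${\tt speceval}_0={\tt false}$. Issue the tasks $(0,j)$, $j=1,\dots,T$. For $i\ge0$ write $\mathcal Q^{i}=\mathcal Q(x^{i})$. *Completion of a task.* The issued tasks are completed one at a time, in any order. When task $(q,j)$ is completed, set $t_q\leftarrow t_q+1$ and add to the model the cut $\mathcal Q_{[j]}(x^q)+g_j^T(x-x^q)$, where $g_j$ is any subgradient of $\mathcal Q_{[j]}$ at $x^q$; this cut is said to be generated at $x^q$. Then: 1. If $t_q=T$, do (a) or (b), remove $q$ from $\mathcal B$, and generate a new iterate. - (a) If $\mathcal Q(x^q)<\mathcal Q^I$, and either $I_q=-1$ or $\mathcal Q(x^q)\le\mathcal Q^{I_q}-\xi(\mathcal Q^{I_q}-m^q)$: set $I\leftarrow q$. If $\mathcal Q(x^q)\le\mathcal Q^{I_q}-\frac12(\mathcal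 Q^{I_q}-m^q)$ and $\|x^q-x^{I_q}\|_\infty=\Delta_q$, set $\Delta_{\rm curr}\leftarrow\max(\Delta_{\rm curr},\min(\Delta_{\rm hi},2\Delta_q))$; when $I_q=-1$ the first of these two conditions may be taken as true or as false. Then delete any cuts that were not generated at $x^q$. - (b) Otherwise, delete any cuts except those that were generated at $x^{I_k}$, those that were active at the solution $x^k$ of its subproblem, and those generated at some $x^\ell$ with $\ell\le k$, $I_\ell=I_k\ne-1$ and $\mathcal Q^{I_k}-m^k>\eta(\mathcal Q^{I_k}-m^\ell)$. Then, if $I_q\neq-1$, let $\rho=\min(1,\Delta_q)\,(\mathcal Q(x^q)-\mathcal Q^{I_q})/(\mathcal Q^{I_q}-m^q)$; if $\rho>0$, increase counter by 1; if $\rho>3$, or counter $\ge3$ and $\rho\in(1,3]$, set $\Delta_{\rm curr}\leftarrow\min(\Delta_{\rm curr},\Delta_q/\min(\rho,4))$ and counter $\leftarrow0$. 2. Otherwise, if $t_q\ge\sigma T$, $|\mathcal B|<K$ and ${\tt speceval}_q$ is false, set ${\tt speceval}_q\leftarrow{\tt true}$ and generate a new iterate. *Generating a new iterate.* Set $k\leftarrow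 k+1$, $\Delta_k\leftarrow\Delta_{\rm curr}$, $I_k\leftarrow I$. Let $x^k$ be a minimizer of $m(x)$ subject to $Ax=b$, $x\ge0$, $\|x-x^I\|_\infty\le\Delta_k$, and let $m^k=m(x^k)$ (the cuts present are such that this subproblem has a finite optimal value). Stop if $I\neq-1$ and $\mathcal Q^I-m^k\le\epsilon_{\rm tol}(1+|\mathcal Q^I|)$. Otherwise add $k$ to $\mathcal B$, set $t_k=0$ and ${\tt speceval}_k={\tt false}$, and issue the tasks $(k,j)$, $j=1,\dots,T$. Assume that, unless the algorithm stops, every issued task is completed after a finite time. **Theorem.** Suppose that $\epsilon_{\rm tol}=0$. Then every execution of Algorithm ATR has one of the following two behaviours. - The algorithm stops, its incumbent index then satisfies $I\ne-1$, and $x^I\in\mathcal S$. - The algorithm never stops. It then generates infinitely many iterates $x^k$, with $I_k\ne-1$ for all large $k$, and $$\|x^{I_k}-P(x^{I_k})\|_\infty\to0\quad(k\to\infty).$$ If moreover the incumbent changes only finitely often, then the last incumbent belongs to $\mathcal S$. In particular, the sequence of incumbents is either finite, ending at a point of $\mathcal S$, or infinite with distance to $\mathcal S$ tending to $0$. -/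

import Mathlib

open scoped Matrix

/-- Data of a two-stage stochastic linear program with fixed recourse matrix `W`: `n` first-stage
variables, `r` first-stage constraints, `n₂` second-stage variables, `r₂` second-stage constraints,
`N` scenarios with probabilities `p i`, grouped into `T` clusters (`cluster i` is the cluster of
scenario `i`). -/
structure TwoStageLP (n r n₂ r₂ N T : ℕ) where
  c : Fin n → ℝ
  A : Matrix (Fin r) (Fin n) ℝ
  b : Fin r → ℝ
  W : Matrix (Fin r₂) (Fin n₂) ℝ
  p : Fin N → ℝ
  q : Fin N → Fin n₂ → ℝ
  h : Fin N → Fin r₂ → ℝ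
  tech : Fin N → Matrix (Fin r₂) (Fin n) ℝ
  cluster : Fin N → Fin T
  p_nonneg : ∀ i, 0 ≤ p i
  p_sum : ∑ i, p i = 1

namespace TwoStageLP

variable {n r n₂ r₂ N T : ℕ} (D : TwoStageLP n r n₂ r₂ N T)

/-- Feasible set of the `i`-th second-stage problem at the first-stage point `x`. -/
def recourseSet (i : Fin N) (x : Fin n → ℝ) : Set (Fin n₂ → ℝ) :=
  {y | D.W *ᵥ y = D.h i - D.tech i *ᵥ x ∧ 0 ≤ y}

/-- Objective values of the `i`-th second-stage problem at `x`. -/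
def recourseValues (i : Fin N) (x : Fin n → ℝ) : Set ℝ :=
  (fun y => D.q i ⬝ᵥ y) '' D.recourseSet i x

/-- Optimal value of the `i`-th second-stage problem at `x`. -/
noncomputable def scenarioQ (i : Fin N) (x : Fin n → ℝ) : ℝ :=
  sInf (D.recourseValues i x)

/-- Partial sum of the expected recourse over cluster `j`. -/
noncomputable def clusterQ (j : Fin T) (x : Fin n → ℝ) : ℝ :=
  ∑ i with D.cluster i = j, D.p i * D.scenarioQ i x

/-- The objective of the first-stage problem. -/
noncomputable def Q (x : Fin n → ℝ) : ℝ :=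
  D.c ⬝ᵥ x + ∑ i, D.p i * D.scenarioQ i x

/-- First-stage feasible set. -/
def feasible : Set (Fin n → ℝ) := {x | D.A *ᵥ x = D.b ∧ 0 ≤ x}

/-- Solution set of `min Q(x)` subject to `A x = b`, `x ≥ 0`. -/
def solutions : Set (Fin n → ℝ) := {x | x ∈ D.feasible ∧ ∀ y ∈ D.feasible, D.Q x ≤ D.Q y}

/-- Complete recourse: every second-stage problem is feasible at every `x`. -/
def CompleteRecourse : Prop := ∀ i x, (D.recourseSet i x).Nonempty

/-- No second-stage problem is unbounded. -/
def RecourseBounded : Prop := ∀ i x, BddBelow (D.recourseValues i x)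

end TwoStageLP

/-- `g` is a subgradient at `x` of the real-valued function `f` on `ℝⁿ`. -/
def IsSubgradient {n : ℕ} (f : (Fin n → ℝ) → ℝ) (x g : Fin n → ℝ) : Prop :=
  ∀ y, f x + g ⬝ᵥ (y - x) ≤ f y

/-- `p` is the Euclidean projection of `x` onto `S`. -/
def IsEuclideanProjection {n : ℕ} (S : Set (Fin n → ℝ)) (x p : Fin n → ℝ) : Prop :=
  p ∈ S ∧ ∀ y ∈ S, (x - p) ⬝ᵥ (x - p) ≤ (x - y) ⬝ᵥ (x - y)

namespace ATR

/-- An optimality cut `θ_j ≥ slope · x + const` for cluster `j`. `origin = some q` if it was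
generated at the iterate `x^q`, `origin = none` if it belongs to the initial model. -/
structure Cut (n T : ℕ) where
  origin : Option ℕ
  cluster : Fin T
  slope : Fin n → ℝ
  const : ℝ

/-- Value at `x` of the affine function that defines a cut. -/
def Cut.val {n T : ℕ} (κ : Cut n T) (x : Fin n → ℝ) : ℝ := κ.slope ⬝ᵥ x + κ.const

/-- Parameters of Algorithm ATR, with the initial model (a finite set of affine minorants of the
cluster functions, possibly empty) and the starting point. -/
structure Params (n T : ℕ) where
  ξ : ℝ
  η : ℝ
  σ : ℝ
  tol : ℝ
  Δhi : ℝ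
  Δinit : ℝ
  K : ℕ
  x0 : Fin n → ℝ
  initCuts : Set (Cut n T)

/-- The ranges from which the algorithm chooses its parameters. -/
structure Params.Admissible {n r n₂ r₂ N T : ℕ} (P : Params n T)
    (D : TwoStageLP n r n₂ r₂ N T) : Prop where
  ξ_mem : P.ξ ∈ Set.Ioo (0 : ℝ) (1 / 2)
  η_mem : P.η ∈ Set.Ico (0 : ℝ) 1
  σ_mem : P.σ ∈ Set.Ioc (0 : ℝ) 1
  tol_nonneg : 0 ≤ P.tol
  Δhi_pos : 0 < P.Δhi
  Δinit_mem : P.Δinit ∈ Set.Ioc (0 : ℝ) P.Δhi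
  K_pos : 0 < P.K
  x0_feasible : P.x0 ∈ D.feasible
  initCuts_finite : P.initCuts.Finite
  initCuts_origin : ∀ κ ∈ P.initCuts, κ.origin = none
  initCuts_minorant : ∀ κ ∈ P.initCuts, ∀ x, κ.val x ≤ D.clusterQ κ.cluster x

/-- State of the master processor between two calls of `act_on_completed_task`.
The index `-1` of the dummy incumbent is `none`. -/
structure State (n T : ℕ) where
  /-- index of the latest iterate -/
  k : ℕ
  /-- the iterates `x^0, …, x^k` -/
  x : ℕ → Fin n → ℝ
  /-- `I_q`, the parent incumbent of `x^q` -/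
  parent : ℕ → Option ℕ
  /-- `Δ_q`, the radius used for `x^q` -/
  Δ : ℕ → ℝ
  /-- `m^q`, the optimal value of the subproblem solved by `x^q` -/
  mval : ℕ → ℝ
  /-- `I`, the index of the incumbent -/
  inc : Option ℕ
  Δcurr : ℝ
  counter : ℕ
  basket : Finset ℕ
  /-- the indices `q` for which `speceval_q` is true -/
  speceval : Finset ℕ
  /-- `t_q`, the number of clusters evaluated at `x^q` -/
  t : ℕ → ℕ
  /-- the cuts that define the current model -/
  cuts : Set (Cut n T)
  /-- the cuts that were active at the solution `x^k` of the latest subproblem -/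
  active : Set (Cut n T)
  /-- the tasks `(q, j)` that have been issued and not yet completed -/
  pending : Finset (ℕ × Fin T)
  stopped : Prop

variable {n r n₂ r₂ N T : ℕ} (D : TwoStageLP n r n₂ r₂ N T) (P : Params n T)

/-- The point `x^I`, where `x^{-1} = x^0` is the starting point. -/
def State.point (s : State n T) (I : Option ℕ) : Fin n → ℝ :=
  match I with
  | none => s.x 0
  | some i => s.x i

/-- `initialization(x^0)`: the tasks `(0, j)` are issued. (`m^0` is not specified, nor ever used.) -/
structure Initial (s : State n T) : Prop where
  k : s.k = 0
  x : s.x 0 = P.x0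
  parent : s.parent 0 = none
  Δ : s.Δ 0 = P.Δinit
  inc : s.inc = none
  Δcurr : s.Δcurr = P.Δinit
  counter : s.counter = 0
  basket : s.basket = ∅
  speceval : s.speceval = ∅
  t : s.t 0 = 0
  cuts : s.cuts = P.initCuts
  active : s.active = ∅
  pending : s.pending = {0} ×ˢ Finset.univ
  stopped : ¬ s.stopped

/-- Feasibility of `(y, θ)` for the linear program form of `trsub(z, Δ)`:
minimize `c · y + ∑ θ_j` subject to all the cuts, `A y = b`, `y ≥ 0` and `‖y - z‖_∞ ≤ Δ`
(the norm of `Fin n → ℝ` is the maximum norm). -/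
def SubFeasible (C : Set (Cut n T)) (z : Fin n → ℝ) (Δ : ℝ)
    (y : Fin n → ℝ) (θ : Fin T → ℝ) : Prop :=
  (∀ κ ∈ C, κ.val y ≤ θ κ.cluster) ∧ y ∈ D.feasible ∧ ‖y - z‖ ≤ Δ

/-- Objective of the linear program form of the subproblem. -/
def subObj (y : Fin n → ℝ) (θ : Fin T → ℝ) : ℝ := D.c ⬝ᵥ y + ∑ j, θ j

/-- `(y, θ)` solves the linear program form of `trsub(z, Δ)` with the cuts `C`. -/
def SubSolution (C : Set (Cut n T)) (z : Fin n → ℝ) (Δ : ℝ)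
    (y : Fin n → ℝ) (θ : Fin T → ℝ) : Prop :=
  SubFeasible D C z Δ y θ ∧
    ∀ y' θ', SubFeasible D C z Δ y' θ' → subObj D y θ ≤ subObj D y' θ'

/-- Effect of the completion of task `(q, j)` with partial subgradient `g` on the counter `t_q`
and on the model. -/
noncomputable def receive (s : State n T) (q : ℕ) (j : Fin T) (g : Fin n → ℝ) : State n T :=
  { s with
    t := Function.update s.t q (s.t q + 1)
    cuts := insert ⟨some q, j, g, D.clusterQ j (s.x q) - g ⬝ᵥ s.x q⟩ s.cuts
    pending := s.pending.erase (q, j) }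

/-- The test for `x^q` to become the new incumbent, where `Q^{-1} = ∞`. -/
def Accept (s : State n T) (q : ℕ) : Prop :=
  (∀ i, s.inc = some i → D.Q (s.x q) < D.Q (s.x i)) ∧
  (∀ i, s.parent q = some i →
    D.Q (s.x q) ≤ D.Q (s.x i) - P.ξ * (D.Q (s.x i) - s.mval q))

open Classical in
/-- `d` is an allowed value of `Δ_curr` after `x^q` has become the incumbent. If `I_q = -1`, then
the comparison with `Q^{-1} = ∞` has no definite meaning and both outcomes are allowed. -/
def RadiusIncrease (s : State n T) (q : ℕ) (d : ℝ) : Prop :=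
  match s.parent q with
  | some i =>
      d = if D.Q (s.x q) ≤ D.Q (s.x i) - (1 / 2) * (D.Q (s.x i) - s.mval q) ∧
            ‖s.x q - s.x i‖ = s.Δ q
          then max s.Δcurr (min P.Δhi (2 * s.Δ q)) else s.Δcurr
  | none =>
      d = s.Δcurr ∨
        (‖s.x q - s.x 0‖ = s.Δ q ∧ d = max s.Δcurr (min P.Δhi (2 * s.Δ q)))

/-- `x^q` becomes the incumbent: the radius may increase and any cuts that do not arise from the
evaluation of `Q(x^q)` may be deleted. -/
def Install (s : State n T) (q : ℕ) (s' : State n T) : Prop :=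
  ∃ (d : ℝ) (C : Set (Cut n T)), RadiusIncrease D P s q d ∧
    C ⊆ s.cuts ∧ (∀ κ ∈ s.cuts, κ.origin = some q → κ ∈ C) ∧
    s' = { s with inc := some q, Δcurr := d, cuts := C }

/-- The cuts that `Model-Update(k)` must not delete: those generated at the parent incumbent of
`x^k`, those active at the solution `x^k` of its subproblem, and those generated at an iterate `x^ℓ`
already generated (`ℓ ≤ k`) with the same parent incumbent `I_ℓ = I_k ≠ -1` and
`Q^{I_k} - m^k > η (Q^{I_k} - m^ℓ)`. -/
def Protected (s : State n T) (κ : Cut n T) : Prop :=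
  (∃ i, s.parent s.k = some i ∧ κ.origin = some i) ∨
  κ ∈ s.active ∨
  (∃ ℓ i, ℓ ≤ s.k ∧ κ.origin = some ℓ ∧ s.parent ℓ = some i ∧ s.parent s.k = some i ∧
    P.η * (D.Q (s.x i) - s.mval ℓ) < D.Q (s.x i) - s.mval s.k)

/-- Outcome `C` of Procedure `Model-Update(k)`. -/
def ModelUpdate (s : State n T) (C : Set (Cut n T)) : Prop :=
  C ⊆ s.cuts ∧ ∀ κ ∈ s.cuts, Protected D P s κ → κ ∈ C

/-- The ratio `ρ` of Procedure `Reduce-Δ(q)`, where `i = I_q`. -/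
noncomputable def rho (s : State n T) (q i : ℕ) : ℝ :=
  min 1 (s.Δ q) * ((D.Q (s.x q) - D.Q (s.x i)) / (D.Q (s.x i) - s.mval q))

open Classical in
/-- Procedure `Reduce-Δ(q)`: the new values of `Δ_curr` and `counter`. -/
noncomputable def reduceDelta (s : State n T) (q : ℕ) : ℝ × ℕ :=
  match s.parent q with
  | none => (s.Δcurr, s.counter)
  | some i =>
      let ρ := rho D s q i
      let cnt := if 0 < ρ then s.counter + 1 else s.counter
      if 3 < ρ ∨ (3 ≤ cnt ∧ 1 < ρ ∧ ρ ≤ 3) then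
        (min s.Δcurr (s.Δ q / min ρ 4), 0)
      else (s.Δcurr, cnt)

/-- `x^q` does not become the incumbent: `Model-Update(k)`, then `Reduce-Δ(q)`. -/
def Reject (s : State n T) (q : ℕ) (s' : State n T) : Prop :=
  ∃ C : Set (Cut n T), ModelUpdate D P s C ∧
    s' = { s with
      cuts := C, Δcurr := (reduceDelta D s q).1, counter := (reduceDelta D s q).2 }

/-- The state after the solution `(y, θ)` of the subproblem has been recorded as `x^{k+1}`. -/
noncomputable def record (s : State n T) (y : Fin n → ℝ) (θ : Fin T → ℝ) : State n T :=
  { s with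
    k := s.k + 1
    x := Function.update s.x (s.k + 1) y
    parent := Function.update s.parent (s.k + 1) s.inc
    Δ := Function.update s.Δ (s.k + 1) s.Δcurr
    mval := Function.update s.mval (s.k + 1) (subObj D y θ)
    active := {κ | κ ∈ s.cuts ∧ κ.val y = θ κ.cluster} }

/-- The convergence test `Q^I - m^k ≤ ε_tol (1 + |Q^I|)`; it fails if `Q^I = Q^{-1} = ∞`. -/
def ConvTest (s : State n T) : Prop :=
  ∃ i, s.inc = some i ∧ D.Q (s.x i) - s.mval s.k ≤ P.tol * (1 + |D.Q (s.x i)|)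

/-- The master issues `evaluate(x^k, k)`. -/
noncomputable def issue (s : State n T) : State n T :=
  { s with
    basket := insert s.k s.basket
    speceval := s.speceval.erase s.k
    t := Function.update s.t s.k 0
    pending := s.pending ∪ ({s.k} ×ˢ Finset.univ) }

/-- Generation of a new iterate: solve `trsub(x^I, Δ_curr)`, then either stop or issue the tasks
of the new iterate. -/
def Generate (s s' : State n T) : Prop :=
  ∃ y θ, SubSolution D s.cuts (s.point s.inc) s.Δcurr y θ ∧
    ((ConvTest D P (record D s y θ) ∧ s' = { record D s y θ with stopped := True }) ∨
     (¬ ConvTest D P (record D s y θ) ∧ s' = issue (record D s y θ)))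

/-- The part of `act_on_completed_task` for `x^q` that follows the arrival of the task's result. -/
def React (s : State n T) (q : ℕ) (s' : State n T) : Prop :=
  (s.t q = T ∧ ∃ u, ((Accept D P s q ∧ Install D P s q u) ∨ (¬ Accept D P s q ∧ Reject D P s q u)) ∧
    Generate D P { u with basket := u.basket.erase q } s') ∨
  (s.t q ≠ T ∧ (P.σ * T ≤ s.t q ∧ s.basket.card < P.K ∧ q ∉ s.speceval) ∧
    Generate D P { s with speceval := insert q s.speceval } s') ∨
  (s.t q ≠ T ∧ ¬ (P.σ * T ≤ s.t q ∧ s.basket.card < P.K ∧ q ∉ s.speceval) ∧ s' = s)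

/-- One call of `act_on_completed_task`: some pending task `(q, j)` is completed and returns the
value and an arbitrary subgradient of `Q_[j]` at `x^q`. -/
def Step (s s' : State n T) : Prop :=
  ∃ q j g, (q, j) ∈ s.pending ∧ IsSubgradient (D.clusterQ j) (s.x q) g ∧
    React D P (receive D s q j g) q s'

/-- A complete execution of Algorithm ATR: `s e` is the state after `e` completed tasks (and stays
the same once the algorithm has stopped), and every task is completed after a finite time unless
the algorithm stops. -/
structure IsRun (s : ℕ → State n T) : Prop where
  init : Initial P (s 0)
  step : ∀ e, ¬ (s e).stopped → Step D P (s e) (s (e + 1))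
  halted : ∀ e, (s e).stopped → s (e + 1) = s e
  tasks_completed : ∀ e, ∀ τ ∈ (s e).pending,
    ∃ e', e ≤ e' ∧ ((s e').stopped ∨ τ ∉ (s e').pending)

end ATR

/-! Hoffman's error bound for polyhedra (`exists_hoffman_bound`) yields two facts about the
objective: it is Lipschitz (constant β), and it grows at least linearly with the distance to the
solution set (constant 1/C, `exists_weak_sharp`). Moving from the incumbent z towards a nearby
solution, convexity shows that a subproblem of radius Δ predicts a decrease of at least min(Q(z) -
Q*, Δ/C) (`SubSolution.gap`). Hence stopping with zero tolerance forces optimality. A radius is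
reduced only when ρ > 1, and the Lipschitz bound then keeps it above min(r₀, (Q(x^I) - Q*)/β)
(`reduceDelta_bounds`).

Suppose now that the algorithm runs forever while the optimality gap of the incumbents stays above
some ε > 0. All predicted decreases then exceed some g > 0. Once the incumbent value is within ξg of
its infimum, no iterate generated afterwards can be accepted, and only finitely many older ones
remain; so the incumbent is eventually constant (`inc_eventually_const_of_gap`). From then on the
model values increase, because active cuts survive and the radius does not grow, so the predicted
decreases fall to a limit G > 0. Close to this limit the η-rule protects every new cut. A rejected
iterate x^l satisfies Q(x^l) ≥ Q^I - ξ(Q^I - m^l), and its retained cuts keep later models high near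
x^l. As ξ < 1/2, every iterate generated after the evaluation of x^l lies at a fixed positive
distance from x^l, which contradicts compactness (`not_eventually_const`).

Thus the incumbent values tend to Q*, and weak sharpness turns this into convergence of distances.
The asynchronous order of the tasks enters through the invariants `Core`, `Tasks` and `Fresh` and
the one-step summary `Transition`. -/

/-! ### Hoffman's error bound by conformal decomposition. -/

/-- With t the least quotient a i / b i over the nonzero entries of a, t * b lies between 0 and a in
every coordinate and meets a in a minimising one. Subtracting it creates a new zero and no new sign.
-/
theorem exists_conformal_step {τ : Type*} [Fintype τ] (a b : τ → ℝ)
    (hab : ∀ i, SignType.sign (a i) = SignType.sign (b i)) (ha : a ≠ 0) :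
    ∃ t > 0, (∀ i, (0 ≤ t * b i ∧ t * b i ≤ a i) ∨ (a i ≤ t * b i ∧ t * b i ≤ 0)) ∧
      ∃ i, a i ≠ 0 ∧ a i = t * b i := by
  classical
  have hne : (Finset.univ.filter fun i => a i ≠ 0).Nonempty := by
    obtain ⟨i, hi⟩ := Function.ne_iff.1 ha
    exact ⟨i, by simpa using hi⟩
  have hpos : ∀ i, a i ≠ 0 → b i ≠ 0 ∧ 0 < a i / b i := by
    intro i hi
    rcases lt_or_gt_of_ne hi with h | h
    · have hb : b i < 0 := by
        rw [← sign_eq_neg_one_iff, ← hab i, sign_eq_neg_one_iff]; exact h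
      exact ⟨hb.ne, div_pos_of_neg_of_neg h hb⟩
    · have hb : 0 < b i := by
        rw [← sign_eq_one_iff, ← hab i, sign_eq_one_iff]; exact h
      exact ⟨hb.ne', div_pos h hb⟩
  obtain ⟨i₀, hi₀, hmin⟩ := Finset.exists_min_image _ (fun i => a i / b i) hne
  have hi₀' : a i₀ ≠ 0 := by simpa using hi₀
  refine ⟨a i₀ / b i₀, (hpos i₀ hi₀').2, fun i => ?_, i₀, hi₀', ?_⟩
  · have ht := (hpos i₀ hi₀').2
    rcases lt_trichotomy (a i) 0 with h | h | h
    · right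
      have hb : b i < 0 := by
        rw [← sign_eq_neg_one_iff, ← hab i, sign_eq_neg_one_iff]; exact h
      have hm := hmin i (by simpa using h.ne)
      refine ⟨?_, (mul_neg_of_pos_of_neg ht hb).le⟩
      have := mul_le_mul_of_nonpos_right hm hb.le
      rwa [div_mul_cancel₀ _ hb.ne] at this
    · left
      have hb : b i = 0 := by
        rw [← sign_eq_zero_iff, ← hab i, h, sign_zero]
      simp [hb, h]
    · left
      have hb : 0 < b i := by
        rw [← sign_eq_one_iff, ← hab i, sign_eq_one_iff]; exact h
      have hm := hmin i (by simpa using h.ne')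
      refine ⟨(mul_pos ht hb).le, ?_⟩
      have := mul_le_mul_of_nonneg_right hm hb.le
      rwa [div_mul_cancel₀ _ hb.ne'] at this
  · rw [div_mul_cancel₀ _ (hpos i₀ hi₀').1]

/-- Hoffman's error bound for the polyhedra `{w ≥ 0 | G w = g}`. -/
theorem exists_hoffman_bound {ι κ : Type*} [Fintype ι] [Fintype κ] (G : (ι → ℝ) →ₗ[ℝ] (κ → ℝ)) :
    ∃ C : ℝ, 0 ≤ C ∧ ∀ u w : ι → ℝ, 0 ≤ u → 0 ≤ w →
      ∃ w', 0 ≤ w' ∧ G w' = G w ∧ ‖w' - u‖ ≤ C * ∑ k, |G (w - u) k| := by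
  classical
  -- Only finitely many sign patterns of (d, G d) exist, and one representative of each determines
  -- the constant. `rep` is 0 on patterns that do not occur.
  let full : (ι → ℝ) → (ι ⊕ κ → ℝ) := fun d => Sum.elim d (G d)
  let pat : (ι → ℝ) → (ι ⊕ κ → SignType) := fun d i => SignType.sign (full d i)
  let rep : (ι ⊕ κ → SignType) → (ι → ℝ) := fun p => if h : ∃ d, pat d = p then h.choose else 0
  have hrep : ∀ d, pat (rep (pat d)) = pat d := by
    intro d
    have h : ∃ d', pat d' = pat d := ⟨d, rfl⟩
    simp only [rep, dif_pos h]
    exact h.choose_spec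
  -- Division by zero gives ratio 0 when the representative lies in the kernel of G; the bound is
  -- never used for these.
  let ratio : (ι ⊕ κ → SignType) → ℝ := fun p => ‖rep p‖ / ∑ k, |G (rep p) k|
  have hratio : ∀ p, 0 ≤ ratio p := fun p => by positivity
  let C := ∑ p, ratio p
  have hC : ∀ p, ratio p ≤ C := fun p =>
    Finset.single_le_sum (f := ratio) (fun p _ => hratio p) (Finset.mem_univ p)
  have hC0 : 0 ≤ C := Finset.sum_nonneg fun p _ => hratio p
  refine ⟨C, hC0, ?_⟩
  -- Induction on the number of nonzero entries of (w - u, G (w - u)), which every conformal step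
  -- lowers.
  suffices key : ∀ m : ℕ, ∀ u w : ι → ℝ,
      (Finset.univ.filter fun i => full (w - u) i ≠ 0).card = m → 0 ≤ u → 0 ≤ w →
      ∃ w', 0 ≤ w' ∧ G w' = G w ∧ ‖w' - u‖ ≤ C * ∑ k, |G (w - u) k| from
    fun u w hu hw => key _ u w rfl hu hw
  intro m
  induction m using Nat.strong_induction_on with
  | _ m ih =>
  intro u w hm hu hw
  by_cases hd : full (w - u) = 0
  · have h0 : w - u = 0 := funext fun i => congrFun hd (Sum.inl i)
    refine ⟨w, hw, rfl, ?_⟩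
    rw [h0]; simp
  set e := rep (pat (w - u)) with he
  obtain ⟨t, ht, hconf, i₀, hi₀, hi₀'⟩ := exists_conformal_step (full (w - u)) (full e)
    (fun i => (congrFun (hrep (w - u)) i).symm) hd
  have hsub : full (w - u - t • e) = fun i => full (w - u) i - t * full e i := by
    funext i
    rcases i with i | k
    · simp [full]
    · simp [full]
  have hcard : (Finset.univ.filter fun i => full (w - u - t • e) i ≠ 0).card < m := by
    rw [← hm]
    refine Finset.card_lt_card ⟨fun i hi => ?_, fun hh => ?_⟩
    · simp only [Finset.mem_filter, Finset.mem_univ, true_and, hsub] at hi ⊢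
      intro h0
      rcases hconf i with h | h <;> apply hi <;> linarith [h.1, h.2]
    · have := hh (by simpa using hi₀ : i₀ ∈ _)
      simp only [Finset.mem_filter, Finset.mem_univ, true_and, hsub] at this
      exact this (by linarith)
  -- A kernel direction moves w, which preserves G w at no cost; any other direction moves u and is
  -- paid for by its residual. Conformality keeps the moved point between u and w, hence
  -- nonnegative.
  by_cases hG : G e = 0
  · have hw1 : 0 ≤ w - t • e := by
      intro i
      have hui := hu i
      have hwi := hw i
      have := hconf (Sum.inl i)
      simp only [full, Sum.elim_inl, Pi.sub_apply, Pi.smul_apply, smul_eq_mul,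
        Pi.zero_apply] at *
      rcases this with h | h <;> linarith [h.1, h.2]
    have hrw : w - t • e - u = w - u - t • e := by abel
    obtain ⟨w', h1, h2, h3⟩ := ih _ hcard u (w - t • e) (by rw [hrw]) hu hw1
    refine ⟨w', h1, by rw [h2]; simp [hG], ?_⟩
    rw [hrw] at h3
    have : G (w - u - t • e) = G (w - u) := by simp [hG]
    rwa [this] at h3
  · have hu1 : 0 ≤ u + t • e := by
      intro i
      have hui := hu i
      have hwi := hw i
      have := hconf (Sum.inl i)
      simp only [full, Sum.elim_inl, Pi.sub_apply, Pi.add_apply, Pi.smul_apply, smul_eq_mul,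
        Pi.zero_apply] at *
      rcases this with h | h <;> linarith [h.1, h.2]
    have hrw : w - (u + t • e) = w - u - t • e := by abel
    obtain ⟨w', h1, h2, h3⟩ := ih _ hcard (u + t • e) w (by rw [hrw]) hu1 hw
    refine ⟨w', h1, h2, ?_⟩
    rw [hrw] at h3
    -- The two summands have compatible signs in each coordinate, so the residual splits without
    -- cancellation and the costs add up to a single factor C.
    have hsum : ∑ k, |G (w - u) k| = t * ∑ k, |G e k| + ∑ k, |G (w - u - t • e) k| := by
      rw [Finset.mul_sum, ← Finset.sum_add_distrib]
      refine Finset.sum_congr rfl fun k _ => ?_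
      have h := hconf (Sum.inr k)
      have h' : G (w - u - t • e) k = G (w - u) k - t * G e k := by simp
      rw [h']
      simp only [full, Sum.elim_inr] at h
      rcases h with h | h
      · rw [abs_of_nonneg (by linarith [h.1, h.2] : 0 ≤ G (w - u) k),
          abs_of_nonneg (by linarith [h.1, h.2] : 0 ≤ G (w - u) k - t * G e k),
          abs_of_nonneg (nonneg_of_mul_nonneg_right h.1 ht)]
        ring
      · rw [abs_of_nonpos (by linarith [h.1, h.2] : G (w - u) k ≤ 0),
          abs_of_nonpos (by linarith [h.1, h.2] : G (w - u) k - t * G e k ≤ 0),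
          abs_of_nonpos (by by_contra hc; push Not at hc; nlinarith [mul_pos ht hc])]
        ring
    have hGpos : 0 < ∑ k, |G e k| := by
      obtain ⟨k, hk⟩ := Function.ne_iff.1 hG
      exact Finset.sum_pos' (fun k _ => abs_nonneg _) ⟨k, Finset.mem_univ k, abs_pos.2 hk⟩
    have hnorm : ‖e‖ ≤ C * ∑ k, |G e k| := by
      have := hC (pat (w - u))
      rwa [div_le_iff₀ hGpos] at this
    calc ‖w' - u‖ = ‖(w' - (u + t • e)) + t • e‖ := by congr 1; abel
      _ ≤ ‖w' - (u + t • e)‖ + ‖t • e‖ := norm_add_le _ _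
      _ = ‖w' - (u + t • e)‖ + t * ‖e‖ := by rw [norm_smul, Real.norm_of_nonneg ht.le]
      _ ≤ C * ∑ k, |G (w - u - t • e) k| + t * (C * ∑ k, |G e k|) := by gcongr
      _ = C * ∑ k, |G (w - u) k| := by rw [hsum]; ring

/-- The image of the nonnegative orthant under a linear map is closed. -/
theorem isClosed_image_nonneg {ι κ : Type*} [Fintype ι] [Fintype κ]
    (G : (ι → ℝ) →ₗ[ℝ] (κ → ℝ)) : IsClosed (G '' {w | 0 ≤ w}) := by
  obtain ⟨C, hC, hH⟩ := exists_hoffman_bound G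
  refine isClosed_of_closure_subset fun g hg => ?_
  obtain ⟨v, hv, hlim⟩ := mem_closure_iff_seq_limit.1 hg
  choose w hw0 hwv using hv
  -- The bound with u = 0 replaces the preimages by bounded ones, so that a subsequence converges.
  choose w' h0 h1 h2 using fun m => hH 0 (w m) le_rfl (hw0 m)
  obtain ⟨B, hB⟩ := (Metric.isBounded_range_of_tendsto v hlim).exists_norm_le
  have hbd : ∀ m, w' m ∈ Metric.closedBall (0 : ι → ℝ) (C * ∑ _k : κ, B) := by
    intro m
    rw [mem_closedBall_zero_iff]
    have := h2 m
    rw [sub_zero, sub_zero] at this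
    refine this.trans ?_
    gcongr with k
    rw [hwv m]
    exact (norm_le_pi_norm (v m) k).trans (hB _ ⟨m, rfl⟩)
  obtain ⟨a, -, φ, hφ, ha⟩ := (isCompact_closedBall (0 : ι → ℝ) (C * ∑ _k : κ, B)).tendsto_subseq hbd
  refine ⟨a, ?_, ?_⟩
  · exact ge_of_tendsto' ha fun m => h0 (φ m)
  · have hc : Continuous G := G.continuous_of_finiteDimensional
    have e1 := (hc.tendsto a).comp ha
    have e2 : (⇑G ∘ (w' ∘ φ)) = v ∘ φ := by
      funext m
      simp only [Function.comp]
      rw [h1, hwv]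
    rw [e2] at e1
    exact tendsto_nhds_unique e1 (hlim.comp hφ.tendsto_atTop)

theorem abs_dotProduct_le {m : Type*} [Fintype m] (a v : m → ℝ) :
    |a ⬝ᵥ v| ≤ (∑ j, |a j|) * ‖v‖ := by
  rw [dotProduct, Finset.sum_mul]
  refine (Finset.abs_sum_le_sum_abs _ _).trans (Finset.sum_le_sum fun j _ => ?_)
  rw [abs_mul]
  gcongr
  exact norm_le_pi_norm v j

/-! ### Recourse functions: attainment, convexity, Lipschitz continuity, weak sharpness. -/

namespace TwoStageLP

variable {n r n₂ r₂ N T : ℕ} {D : TwoStageLP n r n₂ r₂ N T}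

theorem scenarioQ_le (hbdd : D.RecourseBounded) {i : Fin N} {x : Fin n → ℝ} {y : Fin n₂ → ℝ}
    (hy : y ∈ D.recourseSet i x) : D.scenarioQ i x ≤ D.q i ⬝ᵥ y :=
  csInf_le (hbdd i x) ⟨y, hy, rfl⟩

/-- The second-stage problems attain their optimal values. -/
theorem exists_recourse_optimal (hrec : D.CompleteRecourse) (hbdd : D.RecourseBounded)
    (i : Fin N) (x : Fin n → ℝ) :
    ∃ y ∈ D.recourseSet i x, D.q i ⬝ᵥ y = D.scenarioQ i x := by
  -- With the cost added as an extra row, the set of objective values is a slice of a closed cone,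
  -- so its infimum belongs to it.
  let G : (Fin n₂ → ℝ) →ₗ[ℝ] (Fin r₂ ⊕ Unit → ℝ) :=
    { toFun := fun y => Sum.elim (D.W *ᵥ y) (fun _ => D.q i ⬝ᵥ y)
      map_add' := by
        intro y z
        ext k
        rcases k with k | k <;> simp [Matrix.mulVec_add, dotProduct_add]
      map_smul' := by
        intro a y
        ext k
        rcases k with k | k <;> simp [Matrix.mulVec_smul, dotProduct_smul] }
  have hcl := isClosed_image_nonneg G
  have hcont : Continuous fun v : ℝ =>
      (Sum.elim (D.h i - D.tech i *ᵥ x) (fun _ => v) : Fin r₂ ⊕ Unit → ℝ) := by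
    refine continuous_pi fun k => ?_
    rcases k with k | k
    · exact continuous_const
    · exact continuous_id
  have heq : D.recourseValues i x = (fun v : ℝ =>
      (Sum.elim (D.h i - D.tech i *ᵥ x) (fun _ => v) : Fin r₂ ⊕ Unit → ℝ)) ⁻¹'
        (G '' {w | 0 ≤ w}) := by
    ext v
    constructor
    · rintro ⟨y, ⟨hy, hy0⟩, rfl⟩
      exact ⟨y, hy0, by simp [G, hy]⟩
    · rintro ⟨y, hy0, hy⟩
      refine ⟨y, ⟨?_, hy0⟩, ?_⟩
      · funext k
        exact congrFun hy (Sum.inl k)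
      · exact congrFun hy (Sum.inr ())
  have hclosed : IsClosed (D.recourseValues i x) := by
    rw [heq]
    exact hcl.preimage hcont
  obtain ⟨y, hy, hv⟩ := hclosed.csInf_mem ((hrec i x).image _) (hbdd i x)
  exact ⟨y, hy, hv⟩

theorem scenarioQ_convex (hrec : D.CompleteRecourse) (hbdd : D.RecourseBounded) (i : Fin N) :
    ConvexOn ℝ Set.univ (D.scenarioQ i) := by
  refine ⟨convex_univ, fun x _ x' _ a b ha hb hab => ?_⟩
  obtain ⟨y, hy, hv⟩ := exists_recourse_optimal hrec hbdd i x
  obtain ⟨y', hy', hv'⟩ := exists_recourse_optimal hrec hbdd i x'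
  rw [← hv, ← hv']
  have hmem : a • y + b • y' ∈ D.recourseSet i (a • x + b • x') := by
    refine ⟨?_, add_nonneg (smul_nonneg ha hy.2) (smul_nonneg hb hy'.2)⟩
    rw [Matrix.mulVec_add, Matrix.mulVec_smul, Matrix.mulVec_smul, hy.1, hy'.1,
      Matrix.mulVec_add, Matrix.mulVec_smul, Matrix.mulVec_smul]
    have : D.h i = a • D.h i + b • D.h i := by rw [← add_smul, hab, one_smul]
    nth_rewrite 3 [this]
    module
  refine (scenarioQ_le hbdd hmem).trans_eq ?_
  rw [dotProduct_add, dotProduct_smul, dotProduct_smul]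

/-- Hoffman's bound moves an optimal second-stage point at x to a feasible one at x', over a
distance proportional to the change of the right-hand side. -/
theorem scenarioQ_lipschitz (hrec : D.CompleteRecourse) (hbdd : D.RecourseBounded) (i : Fin N) :
    ∃ L : ℝ, 0 ≤ L ∧ ∀ x x', D.scenarioQ i x' ≤ D.scenarioQ i x + L * ‖x' - x‖ := by
  obtain ⟨C, hC, hH⟩ := exists_hoffman_bound (Matrix.mulVecLin D.W)
  refine ⟨(∑ j, |D.q i j|) * (C * ∑ k, ∑ j, |D.tech i k j|), by positivity, fun x x' => ?_⟩
  obtain ⟨y, hy, hv⟩ := exists_recourse_optimal hrec hbdd i x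
  obtain ⟨y', hy'⟩ := hrec i x'
  obtain ⟨w, hw0, hw, hwn⟩ := hH y y' hy.2 hy'.2
  have hmem : w ∈ D.recourseSet i x' := ⟨by simpa using hw.trans hy'.1, hw0⟩
  have hdiff : ∀ k, |(Matrix.mulVecLin D.W) (y' - y) k| ≤ (∑ j, |D.tech i k j|) * ‖x' - x‖ := by
    intro k
    have : (Matrix.mulVecLin D.W) (y' - y) = D.tech i *ᵥ (x - x') := by
      rw [map_sub, Matrix.mulVecLin_apply, Matrix.mulVecLin_apply, hy.1, hy'.1, Matrix.mulVec_sub]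
      abel
    rw [this, norm_sub_rev]
    exact abs_dotProduct_le _ _
  have hwy : ‖w - y‖ ≤ C * ((∑ k, ∑ j, |D.tech i k j|) * ‖x' - x‖) := by
    refine hwn.trans ?_
    rw [Finset.sum_mul]
    gcongr with k
    exact hdiff k
  calc D.scenarioQ i x' ≤ D.q i ⬝ᵥ w := scenarioQ_le hbdd hmem
    _ = D.q i ⬝ᵥ y + D.q i ⬝ᵥ (w - y) := by rw [dotProduct_sub]; ring
    _ ≤ D.scenarioQ i x + (∑ j, |D.q i j|) * ‖w - y‖ := by
        rw [hv]
        gcongr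
        exact (le_abs_self _).trans (abs_dotProduct_le _ _)
    _ ≤ D.scenarioQ i x + (∑ j, |D.q i j|) * (C * ((∑ k, ∑ j, |D.tech i k j|) * ‖x' - x‖)) := by
        gcongr
    _ = _ := by ring

theorem Q_eq_sum_clusterQ (x : Fin n → ℝ) : D.Q x = D.c ⬝ᵥ x + ∑ j, D.clusterQ j x := by
  rw [Q]
  congr 1
  simp only [clusterQ]
  rw [Finset.sum_fiberwise]

theorem clusterQ_lipschitz (hrec : D.CompleteRecourse) (hbdd : D.RecourseBounded) :
    ∃ L : ℝ, 0 ≤ L ∧ ∀ j x x', D.clusterQ j x' ≤ D.clusterQ j x + L * ‖x' - x‖ := by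
  choose L hL0 hL using scenarioQ_lipschitz hrec hbdd
  refine ⟨∑ i, D.p i * L i, Finset.sum_nonneg fun i _ => mul_nonneg (D.p_nonneg i) (hL0 i),
    fun j x x' => ?_⟩
  have h1 : D.clusterQ j x' ≤
      D.clusterQ j x + (∑ i with D.cluster i = j, D.p i * L i) * ‖x' - x‖ := by
    rw [clusterQ, clusterQ, Finset.sum_mul, ← Finset.sum_add_distrib]
    refine Finset.sum_le_sum fun i _ => ?_
    have := mul_le_mul_of_nonneg_left (hL i x x') (D.p_nonneg i)
    linarith
  refine h1.trans ?_
  gcongr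
  · exact fun i _ _ => mul_nonneg (D.p_nonneg i) (hL0 i)
  · exact Finset.subset_univ _

theorem Q_lipschitz (hrec : D.CompleteRecourse) (hbdd : D.RecourseBounded) :
    ∃ β : ℝ, 0 < β ∧ ∀ x x', D.Q x' ≤ D.Q x + β * ‖x' - x‖ := by
  obtain ⟨L, hL0, hL⟩ := clusterQ_lipschitz hrec hbdd
  refine ⟨(∑ k, |D.c k|) + ∑ _j : Fin T, L + 1, by positivity, fun x x' => ?_⟩
  rw [Q_eq_sum_clusterQ, Q_eq_sum_clusterQ]
  have h1 : D.c ⬝ᵥ x' ≤ D.c ⬝ᵥ x + (∑ k, |D.c k|) * ‖x' - x‖ := by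
    have := (le_abs_self _).trans (abs_dotProduct_le D.c (x' - x))
    rw [dotProduct_sub] at this
    linarith
  have h2 : ∑ j, D.clusterQ j x' ≤ ∑ j, D.clusterQ j x + (∑ _j : Fin T, L) * ‖x' - x‖ := by
    rw [Finset.sum_mul, ← Finset.sum_add_distrib]
    exact Finset.sum_le_sum fun j _ => hL j x x'
  have h3 := norm_nonneg (x' - x)
  nlinarith

theorem Q_continuous (hrec : D.CompleteRecourse) (hbdd : D.RecourseBounded) :
    Continuous D.Q := by
  obtain ⟨β, hβ, h⟩ := Q_lipschitz hrec hbdd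
  refine (LipschitzWith.of_dist_le_mul (K := ⟨β, hβ.le⟩) fun x y => ?_).continuous
  rw [Real.dist_eq, abs_le, dist_eq_norm]
  have h1 := h x y
  have h2 := h y x
  rw [norm_sub_rev] at h1
  change -(β * _) ≤ _ ∧ _ ≤ β * _
  constructor <;> linarith

theorem Q_convex (hrec : D.CompleteRecourse) (hbdd : D.RecourseBounded) :
    ConvexOn ℝ Set.univ D.Q := by
  refine ⟨convex_univ, fun x _ x' _ a b ha hb hab => ?_⟩
  simp only [Q, dotProduct_add, dotProduct_smul, smul_eq_mul, mul_add, Finset.mul_sum]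
  have : ∑ i, D.p i * D.scenarioQ i (a • x + b • x') ≤
      ∑ i, a * (D.p i * D.scenarioQ i x) + ∑ i, b * (D.p i * D.scenarioQ i x') := by
    rw [← Finset.sum_add_distrib]
    refine Finset.sum_le_sum fun i _ => ?_
    have h1 := (scenarioQ_convex hrec hbdd i).2 (Set.mem_univ x) (Set.mem_univ x') ha hb hab
    have := mul_le_mul_of_nonneg_left h1 (D.p_nonneg i)
    simp only [smul_eq_mul] at this
    linarith
  linarith

theorem feasible_convex : Convex ℝ D.feasible := by
  intro x hx x' hx' a b ha hb hab
  refine ⟨?_, add_nonneg (smul_nonneg ha hx.2) (smul_nonneg hb hx'.2)⟩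
  rw [Matrix.mulVec_add, Matrix.mulVec_smul, Matrix.mulVec_smul, hx.1, hx'.1, ← add_smul, hab,
    one_smul]

theorem feasible_isClosed : IsClosed D.feasible := by
  refine IsClosed.inter (isClosed_eq ?_ continuous_const) (isClosed_le continuous_const continuous_id)
  exact (Matrix.mulVecLin D.A).continuous_of_finiteDimensional

theorem solutions_isClosed (hrec : D.CompleteRecourse) (hbdd : D.RecourseBounded) :
    IsClosed D.solutions := by
  have : D.solutions = D.feasible ∩ ⋂ y ∈ D.feasible, {x | D.Q x ≤ D.Q y} := by
    ext x
    simp [solutions]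
  rw [this]
  exact feasible_isClosed.inter (isClosed_biInter fun y _ =>
    isClosed_le (Q_continuous hrec hbdd) continuous_const)

/-- Weak sharpness of the solution set: the objective grows linearly with the distance to it. -/
theorem exists_weak_sharp (hrec : D.CompleteRecourse) (hbdd : D.RecourseBounded)
    {xs : Fin n → ℝ} (hxs : xs ∈ D.solutions) :
    ∃ C : ℝ, 0 < C ∧ ∀ x ∈ D.feasible, ∃ s ∈ D.solutions, ‖s - x‖ ≤ C * (D.Q x - D.Q xs) := by
  -- The constraint map of the extensive form in (x, y₁, …, y_N), with the objective as last row: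
  -- prescribing the optimal value there describes the optimal set as a polyhedron.
  let G : (Fin n ⊕ Fin N × Fin n₂ → ℝ) →ₗ[ℝ] ((Fin r ⊕ Fin N × Fin r₂) ⊕ Unit → ℝ) :=
    { toFun := fun u => Sum.elim (Sum.elim (D.A *ᵥ (u ∘ Sum.inl))
          (fun ik => (D.W *ᵥ (u ∘ Sum.inr ∘ Prod.mk ik.1) + D.tech ik.1 *ᵥ (u ∘ Sum.inl)) ik.2))
          (fun _ => D.c ⬝ᵥ (u ∘ Sum.inl) +
            ∑ i, D.p i * (D.q i ⬝ᵥ (u ∘ Sum.inr ∘ Prod.mk i)))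
      map_add' := by
        intro u v
        have e1 : (u + v) ∘ Sum.inl = u ∘ (Sum.inl : Fin n → _) + v ∘ Sum.inl := rfl
        have e2 : ∀ i : Fin N, (u + v) ∘ Sum.inr ∘ Prod.mk i =
          u ∘ Sum.inr ∘ Prod.mk i + v ∘ Sum.inr ∘ Prod.mk i := fun i => rfl
        ext k
        rcases k with (k | k) | k
        · simp only [e1, Matrix.mulVec_add, Sum.elim_inl, Pi.add_apply]
        · simp only [e1, e2, Matrix.mulVec_add, Sum.elim_inl, Sum.elim_inr, Pi.add_apply]
          ring
        · simp only [e1, e2, dotProduct_add, Sum.elim_inr, Pi.add_apply, mul_add,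
            Finset.sum_add_distrib]
          ring
      map_smul' := by
        intro a u
        have e1 : (a • u) ∘ Sum.inl = a • (u ∘ (Sum.inl : Fin n → _)) := rfl
        have e2 : ∀ i : Fin N, (a • u) ∘ Sum.inr ∘ Prod.mk i =
          a • (u ∘ Sum.inr ∘ Prod.mk i) := fun i => rfl
        ext k
        rcases k with (k | k) | k
        · simp only [e1, Matrix.mulVec_smul, Sum.elim_inl, Pi.smul_apply, RingHom.id_apply]
        · simp only [e1, e2, Matrix.mulVec_smul, Sum.elim_inl, Sum.elim_inr, Pi.smul_apply,
            Pi.add_apply, RingHom.id_apply, smul_add]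
        · simp only [e1, e2, dotProduct_smul, Sum.elim_inr, Pi.smul_apply, RingHom.id_apply,
            smul_eq_mul, mul_add, Finset.mul_sum]
          congr 1
          exact Finset.sum_congr rfl fun i _ => by ring }
  obtain ⟨C, hC, hH⟩ := exists_hoffman_bound G
  choose Y hY hYv using exists_recourse_optimal hrec hbdd
  let lift : (Fin n → ℝ) → (Fin n ⊕ Fin N × Fin n₂ → ℝ) :=
    fun x => Sum.elim x (fun il => Y il.1 x il.2)
  have hlift0 : ∀ x ∈ D.feasible, 0 ≤ lift x := by
    intro x hx k
    rcases k with k | k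
    · exact hx.2 k
    · exact (hY k.1 x).2 k.2
  have hliftG : ∀ x ∈ D.feasible, G (lift x) =
      Sum.elim (Sum.elim D.b (fun ik => D.h ik.1 ik.2)) (fun _ => D.Q x) := by
    intro x hx
    have e1 : lift x ∘ Sum.inl = x := rfl
    have e2 : ∀ i, lift x ∘ Sum.inr ∘ Prod.mk i = Y i x := fun i => rfl
    ext k
    rcases k with (k | k) | k
    · simp only [G, LinearMap.coe_mk, AddHom.coe_mk, Sum.elim_inl, e1, hx.1]
    · simp only [G, LinearMap.coe_mk, AddHom.coe_mk, Sum.elim_inl, Sum.elim_inr, e1, e2,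
        (hY k.1 x).1]
      simp
    · simp only [G, LinearMap.coe_mk, AddHom.coe_mk, Sum.elim_inr, e1, e2, hYv, Q]
  refine ⟨C + 1, by positivity, fun x hx => ?_⟩
  -- Both lifts satisfy the same constraint rows, so the residual is the difference of the objective
  -- values alone.
  obtain ⟨w, hw0, hw, hwn⟩ := hH (lift x) (lift xs) (hlift0 x hx) (hlift0 xs hxs.1)
  rw [hliftG xs hxs.1] at hw
  have hfeas : w ∘ Sum.inl ∈ D.feasible :=
    ⟨funext fun k => congrFun hw (Sum.inl (Sum.inl k)), fun k => hw0 (Sum.inl k)⟩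
  have hmem : ∀ i, w ∘ Sum.inr ∘ Prod.mk i ∈ D.recourseSet i (w ∘ Sum.inl) := by
    intro i
    refine ⟨funext fun k => ?_, fun l => hw0 (Sum.inr (i, l))⟩
    have := congrFun hw (Sum.inl (Sum.inr (i, k)))
    simp only [G, LinearMap.coe_mk, AddHom.coe_mk, Sum.elim_inl, Sum.elim_inr, Pi.add_apply] at this
    rw [Pi.sub_apply]
    linarith
  -- The second-stage part of w is feasible, though perhaps not optimal, which bounds Q by the
  -- prescribed objective from the right side.
  have hle : D.Q (w ∘ Sum.inl) ≤ D.Q xs := by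
    have := congrFun hw (Sum.inr ())
    simp only [G, LinearMap.coe_mk, AddHom.coe_mk, Sum.elim_inr] at this
    rw [← this, Q]
    gcongr with i
    · exact D.p_nonneg i
    · exact scenarioQ_le hbdd (hmem i)
  refine ⟨w ∘ Sum.inl, ⟨hfeas, fun y hy => hle.trans (hxs.2 y hy)⟩, ?_⟩
  have hgap : 0 ≤ D.Q x - D.Q xs := sub_nonneg.2 (hxs.2 x hx)
  have hsum : ∑ k, |G (lift xs - lift x) k| = D.Q x - D.Q xs := by
    rw [map_sub, hliftG x hx, hliftG xs hxs.1]
    simp only [Fintype.sum_sum_type, Pi.sub_apply, Sum.elim_inl, Sum.elim_inr, sub_self, abs_zero,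
      Finset.sum_const_zero, zero_add, Finset.univ_unique, Finset.sum_singleton]
    rw [abs_sub_comm, abs_of_nonneg hgap]
  rw [hsum] at hwn
  have : ‖w ∘ Sum.inl - x‖ ≤ ‖w - lift x‖ :=
    (pi_norm_le_iff_of_nonneg (norm_nonneg _)).2 fun k => norm_le_pi_norm (w - lift x) (Sum.inl k)
  linarith

end TwoStageLP

/-! ### Euclidean projection measured in the maximum norm. -/

theorem exists_isEuclideanProjection {n : ℕ} {S : Set (Fin n → ℝ)} (hS : IsClosed S)
    (hne : S.Nonempty) (x : Fin n → ℝ) : ∃ p, IsEuclideanProjection S x p := by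
  let S' : Set (EuclideanSpace ℝ (Fin n)) := WithLp.ofLp ⁻¹' S
  have hS' : IsClosed S' := hS.preimage (PiLp.continuous_ofLp 2 _)
  have hne' : S'.Nonempty := by
    obtain ⟨s, hs⟩ := hne
    exact ⟨WithLp.toLp 2 s, hs⟩
  obtain ⟨p, hp, hd⟩ := hS'.exists_infDist_eq_dist hne' (WithLp.toLp 2 x)
  have hdist : ∀ y : Fin n → ℝ,
      (x - y) ⬝ᵥ (x - y) = dist (WithLp.toLp 2 x) (WithLp.toLp 2 y) ^ 2 := by
    intro y
    rw [EuclideanSpace.dist_eq, Real.sq_sqrt (by positivity)]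
    simp only [dotProduct, Real.dist_eq, sq_abs, Pi.sub_apply]
    exact Finset.sum_congr rfl fun i _ => by ring
  refine ⟨p.ofLp, hp, fun y hy => ?_⟩
  rw [hdist, hdist]
  have : dist (WithLp.toLp 2 x) p ≤ dist (WithLp.toLp 2 x) (WithLp.toLp 2 y) := by
    rw [← hd]
    exact Metric.infDist_le_dist_of_mem (by exact hy)
  exact pow_le_pow_left₀ dist_nonneg this 2

/-- Comparison of the Euclidean and maximum norms; n + 1 stands in for √n and avoids square roots.
-/
theorem IsEuclideanProjection.norm_sub_le {n : ℕ} {S : Set (Fin n → ℝ)} {x p s : Fin n → ℝ}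
    (hp : IsEuclideanProjection S x p) (hs : s ∈ S) : ‖x - p‖ ≤ (n + 1) * ‖s - x‖ := by
  refine (pi_norm_le_iff_of_nonneg (by positivity)).2 fun i => ?_
  rw [Real.norm_eq_abs]
  refine abs_le_of_sq_le_sq ?_ (by positivity)
  have h1 : (x - p) i ^ 2 ≤ (x - p) ⬝ᵥ (x - p) := by
    rw [dotProduct, sq]
    exact Finset.single_le_sum (f := fun i => (x - p) i * (x - p) i)
      (fun i _ => mul_self_nonneg _) (Finset.mem_univ i)
  have h2 : (x - s) ⬝ᵥ (x - s) ≤ n * ‖s - x‖ ^ 2 := by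
    rw [dotProduct, norm_sub_rev]
    calc ∑ i, (x - s) i * (x - s) i ≤ ∑ _i : Fin n, ‖x - s‖ ^ 2 := by
          refine Finset.sum_le_sum fun i _ => ?_
          rw [← sq, ← sq_abs]
          exact pow_le_pow_left₀ (abs_nonneg _) (norm_le_pi_norm (x - s) i) 2
      _ = n * ‖x - s‖ ^ 2 := by simp
  have h3 := hp.2 s hs
  have h4 : (n : ℝ) ≤ ((n : ℝ) + 1) ^ 2 := by nlinarith [(Nat.cast_nonneg n : (0 : ℝ) ≤ n)]
  calc (x - p) i ^ 2 ≤ n * ‖s - x‖ ^ 2 := h1.trans (h3.trans h2)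
    _ ≤ (n + 1) ^ 2 * ‖s - x‖ ^ 2 := by gcongr
    _ = _ := by ring

/-! ### Estimates for the trust-region subproblem. -/

/-- The properties of the objective on which the convergence analysis rests: `Qs` is its optimal
value, `C` a constant of weak sharpness and `β` a Lipschitz constant. -/
structure TwoStageLP.Regular {n r n₂ r₂ N T : ℕ} (D : TwoStageLP n r n₂ r₂ N T)
    (Qs C β : ℝ) : Prop where
  C_pos : 0 < C
  β_pos : 0 < β
  lower : ∀ x ∈ D.feasible, Qs ≤ D.Q x
  sharp : ∀ x ∈ D.feasible, ∃ s ∈ D.feasible, D.Q s = Qs ∧ ‖s - x‖ ≤ C * (D.Q x - Qs)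
  lipschitz : ∀ x x', D.Q x' ≤ D.Q x + β * ‖x' - x‖
  convex : ConvexOn ℝ Set.univ D.Q

namespace ATR

variable {n r n₂ r₂ N T : ℕ} {D : TwoStageLP n r n₂ r₂ N T} {P : Params n T} {Qs C β r₀ : ℝ}

theorem Cut.val_combo (κ : Cut n T) (y y' : Fin n → ℝ) {a b : ℝ} (hab : a + b = 1) :
    κ.val (a • y + b • y') = a * κ.val y + b * κ.val y' := by
  simp only [Cut.val, dotProduct_add, dotProduct_smul, smul_eq_mul]
  linear_combination (-κ.const) * hab

theorem subObj_combo (y y' : Fin n → ℝ) (θ θ' : Fin T → ℝ) (a b : ℝ) :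
    subObj D (a • y + b • y') (a • θ + b • θ') = a * subObj D y θ + b * subObj D y' θ' := by
  simp only [subObj, dotProduct_add, dotProduct_smul, smul_eq_mul, Pi.add_apply, Pi.smul_apply,
    Finset.sum_add_distrib, ← Finset.mul_sum]
  ring

/-- The decrease predicted by the model is bounded below in terms of the optimality gap. -/
theorem SubSolution.gap (hD : D.Regular Qs C β) {S : Set (Cut n T)} {z y : Fin n → ℝ} {Δ : ℝ}
    {θ : Fin T → ℝ} (hsol : SubSolution D S z Δ y θ)
    (hmin : ∀ κ ∈ S, ∀ x, κ.val x ≤ D.clusterQ κ.cluster x) (hz : z ∈ D.feasible) (hΔ : 0 < Δ) :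
    min (D.Q z - Qs) (Δ / C) ≤ D.Q z - subObj D y θ := by
  obtain ⟨s, hs, hQs, hdist⟩ := hD.sharp z hz
  -- The point at fraction t of the way to a nearest-enough solution s competes in the subproblem;
  -- there the model is below Q, and Q is below its chord.
  have key : ∀ t : ℝ, 0 ≤ t → t ≤ 1 → t * ‖s - z‖ ≤ Δ →
      t * (D.Q z - Qs) ≤ D.Q z - subObj D y θ := by
    intro t ht0 ht1 htΔ
    set x := (1 - t) • z + t • s with hx
    have hxf : x ∈ D.feasible :=
      TwoStageLP.feasible_convex hz hs (by linarith) ht0 (by ring)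
    have hxz : x - z = t • (s - z) := by rw [hx]; module
    have h1 := hsol.2 x (fun j => D.clusterQ j x)
      ⟨fun κ hκ => hmin κ hκ x, hxf, by
        rw [hxz, norm_smul, Real.norm_of_nonneg ht0]; exact htΔ⟩
    have h2 : subObj D x (fun j => D.clusterQ j x) = D.Q x := by
      rw [TwoStageLP.Q_eq_sum_clusterQ, subObj]
    have h3 := hD.convex.2 (Set.mem_univ z) (Set.mem_univ s) (by linarith : 0 ≤ 1 - t) ht0
      (by ring)
    simp only [smul_eq_mul] at h3
    rw [hQs] at h3
    rw [h2] at h1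
    linarith
  have hδ : 0 ≤ D.Q z - Qs := sub_nonneg.2 (hD.lower z hz)
  rcases le_or_gt (C * (D.Q z - Qs)) Δ with h | h
  · have := key 1 zero_le_one le_rfl (by linarith)
    rw [one_mul] at this
    exact (min_le_left _ _).trans this
  · have hpos : 0 < C * (D.Q z - Qs) := hΔ.trans h
    -- The longest fraction that weak sharpness certifies to stay in the trust region.
    have := key (Δ / (C * (D.Q z - Qs))) (by positivity) ((div_le_one hpos).2 h.le) (by
      calc Δ / (C * (D.Q z - Qs)) * ‖s - z‖ ≤ Δ / (C * (D.Q z - Qs)) * (C * (D.Q z - Qs)) := by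
            gcongr
        _ = Δ := div_mul_cancel₀ _ hpos.ne')
    refine (min_le_right _ _).trans (le_trans (le_of_eq ?_) this)
    have h1 : D.Q z - Qs ≠ 0 := fun h0 => by rw [h0, mul_zero] at hpos; exact hpos.false
    have h2 := hD.C_pos.ne'
    field_simp

/-- The cuts that are active at a solution of the subproblem determine its optimal value. -/
theorem SubSolution.le_of_active {S : Set (Cut n T)} (hS : S.Finite) {z y : Fin n → ℝ} {Δ : ℝ}
    {θ : Fin T → ℝ} (hsol : SubSolution D S z Δ y θ) {y' : Fin n → ℝ} {θ' : Fin T → ℝ}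
    (h : SubFeasible D {κ | κ ∈ S ∧ κ.val y = θ κ.cluster} z Δ y' θ') :
    subObj D y θ ≤ subObj D y' θ' := by
  -- A short step from (y, θ) towards (y', θ') respects the active cuts by convexity and the
  -- finitely many inactive ones by their slack, so optimality of (y, θ) applies to it.
  have hev : ∀ κ ∈ S, ∀ᶠ t : ℝ in nhdsWithin 0 (Set.Ioi 0),
      (1 - t) * κ.val y + t * κ.val y' ≤ (1 - t) * θ κ.cluster + t * θ' κ.cluster := by
    intro κ hκ
    rcases (hsol.1.1 κ hκ).eq_or_lt with he | hlt
    · filter_upwards [self_mem_nhdsWithin] with t ht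
      have := mul_le_mul_of_nonneg_left (h.1 κ ⟨hκ, he⟩) (Set.mem_Ioi.1 ht).le
      rw [he]
      linarith
    · refine Filter.Eventually.filter_mono nhdsWithin_le_nhds ?_
      have h1 : Continuous fun t : ℝ => (1 - t) * κ.val y + t * κ.val y' := by fun_prop
      have h2 : Continuous fun t : ℝ => (1 - t) * θ κ.cluster + t * θ' κ.cluster := by fun_prop
      filter_upwards [(h1.tendsto 0).eventually_lt (h2.tendsto 0) (by simpa using hlt)] with t ht
      exact ht.le
  have hall := (Set.Finite.eventually_all hS).2 hev
  have h1 : ∀ᶠ t : ℝ in nhdsWithin 0 (Set.Ioi 0), t < 1 :=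
    Filter.Eventually.filter_mono nhdsWithin_le_nhds (gt_mem_nhds zero_lt_one)
  obtain ⟨t, ht, ht1, ht0⟩ := (hall.and (h1.and self_mem_nhdsWithin)).exists
  have ht0 : 0 < t := ht0
  have hfeas : SubFeasible D S z Δ ((1 - t) • y + t • y') ((1 - t) • θ + t • θ') := by
    refine ⟨fun κ hκ => ?_,
      TwoStageLP.feasible_convex hsol.1.2.1 h.2.1 (by linarith) ht0.le (by ring), ?_⟩
    · rw [Cut.val_combo _ _ _ (by ring)]
      simpa using ht κ hκ
    · have e : (1 - t) • y + t • y' - z = (1 - t) • (y - z) + t • (y' - z) := by module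
      rw [e]
      refine (norm_add_le _ _).trans ?_
      rw [norm_smul, norm_smul, Real.norm_of_nonneg ht0.le,
        Real.norm_of_nonneg (by linarith : 0 ≤ 1 - t)]
      have h1 := mul_le_mul_of_nonneg_left hsol.1.2.2 (by linarith : 0 ≤ 1 - t)
      have h2 := mul_le_mul_of_nonneg_left h.2.2 ht0.le
      linarith
  have := hsol.2 _ _ hfeas
  rw [subObj_combo] at this
  have h3 : t * subObj D y θ ≤ t * subObj D y' θ' := by linarith
  exact le_of_mul_le_mul_left h3 ht0

/-- Slopes of cuts that touch a Lipschitz cluster function are bounded. -/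
theorem Cut.val_ge {L : ℝ} (hL : ∀ j x x', D.clusterQ j x' ≤ D.clusterQ j x + L * ‖x' - x‖)
    {κ : Cut n T} {x : Fin n → ℝ} (hmin : ∀ y, κ.val y ≤ D.clusterQ κ.cluster y)
    (htouch : κ.val x = D.clusterQ κ.cluster x) (y : Fin n → ℝ) :
    D.clusterQ κ.cluster x - L * ‖y - x‖ ≤ κ.val y := by
  -- The upper bound is taken at the reflection of y in x; since the cut is affine, it becomes a
  -- lower bound at y.
  have h1 := (hmin (x - (y - x))).trans (hL κ.cluster x (x - (y - x)))
  have h2 : κ.val (x - (y - x)) = 2 * κ.val x - κ.val y := by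
    simp only [Cut.val, dotProduct_sub]
    ring
  have h3 : x - (y - x) - x = -(y - x) := by abel
  rw [h2, h3, norm_neg] at h1
  linarith

/-! ### Invariants of the state and the lower bound on the radius. -/

/-- Invariants of the master processor. -/
structure Core (D : TwoStageLP n r n₂ r₂ N T) (P : Params n T) (Qs C β r₀ : ℝ)
    (s : State n T) : Prop where
  x_feas : ∀ q ≤ s.k, s.x q ∈ D.feasible
  inc_le : ∀ i, s.inc = some i → i ≤ s.k
  parent_lt : ∀ q ≤ s.k, ∀ i, s.parent q = some i → i < q
  cuts_fin : s.cuts.Finite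
  cuts_minorant : ∀ κ ∈ s.cuts, ∀ y, κ.val y ≤ D.clusterQ κ.cluster y
  cuts_touch : ∀ κ ∈ s.cuts, ∀ l, κ.origin = some l →
    l ≤ s.k ∧ κ.val (s.x l) = D.clusterQ κ.cluster (s.x l)
  radius_pos : ∀ q ≤ s.k, 0 < s.Δ q
  radius_le : ∀ q ≤ s.k, s.Δ q ≤ P.Δhi
  curr_pos : 0 < s.Δcurr
  curr_le : s.Δcurr ≤ P.Δhi
  parent_inc : ∀ q ≤ s.k, ∀ i, s.parent q = some i →
    ∃ i', s.inc = some i' ∧ D.Q (s.x i') ≤ D.Q (s.x i)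
  trust : ∀ q ≤ s.k, ∀ i, s.parent q = some i → ‖s.x q - s.x i‖ ≤ s.Δ q
  gap : ∀ q ≤ s.k, ∀ i, s.parent q = some i →
    min (D.Q (s.x i) - Qs) (s.Δ q / C) ≤ D.Q (s.x i) - s.mval q
  -- With the next two fields: radii stay above a bound that can vanish only together with the
  -- optimality gap.
  curr_none : s.inc = none → r₀ ≤ s.Δcurr
  curr_some : ∀ i, s.inc = some i → min r₀ ((D.Q (s.x i) - Qs) / β) ≤ s.Δcurr
  radius_ge : ∀ q ≤ s.k, ∀ i, s.parent q = some i → min r₀ ((D.Q (s.x i) - Qs) / β) ≤ s.Δ q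
  accepted : ∀ q i, s.inc = some q → s.parent q = some i →
    D.Q (s.x q) ≤ D.Q (s.x i) - P.ξ * (D.Q (s.x i) - s.mval q)
  -- The active cuts alone certify m^k, which makes model values monotone although other cuts are
  -- deleted.
  active_opt : ∀ i, s.parent s.k = some i → ∀ y θ,
    SubFeasible D s.active (s.x i) (s.Δ s.k) y θ → s.mval s.k ≤ subObj D y θ

theorem Core.initial (hP : P.Admissible D) (hr₀ : r₀ ≤ P.Δinit) {s : State n T}
    (h : Initial P s) : Core D P Qs C β r₀ s := by
  have hk : ∀ q ≤ s.k, q = 0 := fun q hq => by rw [h.k] at hq; omega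
  have hpar : ∀ q ≤ s.k, ∀ i, s.parent q ≠ some i := fun q hq i => by
    rw [hk q hq, h.parent]; simp
  have hinc : ∀ i, s.inc ≠ some i := fun i => by rw [h.inc]; simp
  constructor
  · intro q hq; rw [hk q hq, h.x]; exact hP.x0_feasible
  · intro i hi; exact absurd hi (hinc i)
  · intro q hq i hi; exact absurd hi (hpar q hq i)
  · rw [h.cuts]; exact hP.initCuts_finite
  · rw [h.cuts]; exact hP.initCuts_minorant
  · intro κ hκ l hl
    rw [h.cuts] at hκ
    rw [hP.initCuts_origin κ hκ] at hl
    simp at hl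
  · intro q hq; rw [hk q hq, h.Δ]; exact hP.Δinit_mem.1
  · intro q hq; rw [hk q hq, h.Δ]; exact hP.Δinit_mem.2
  · rw [h.Δcurr]; exact hP.Δinit_mem.1
  · rw [h.Δcurr]; exact hP.Δinit_mem.2
  · intro q hq i hi; exact absurd hi (hpar q hq i)
  · intro q hq i hi; exact absurd hi (hpar q hq i)
  · intro q hq i hi; exact absurd hi (hpar q hq i)
  · intro _; rw [h.Δcurr]; exact hr₀
  · intro i hi; exact absurd hi (hinc i)
  · intro q hq i hi; exact absurd hi (hpar q hq i)
  · intro q i hi; exact absurd hi (hinc q)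
  · intro i hi; exact absurd hi (hpar _ le_rfl i)

theorem Core.receive {s : State n T} (h : Core D P Qs C β r₀ s) {q : ℕ} (hq : q ≤ s.k) {j : Fin T}
    {g : Fin n → ℝ} (hg : IsSubgradient (D.clusterQ j) (s.x q) g) :
    Core D P Qs C β r₀ (receive D s q j g) :=
  { h with
    cuts_fin := h.cuts_fin.insert _
    cuts_minorant := by
      rintro κ (rfl | hκ) y
      · have := hg y
        rw [dotProduct_sub] at this
        simp only [Cut.val]
        linarith
      · exact h.cuts_minorant κ hκ y
    cuts_touch := by
      rintro κ (rfl | hκ) l hl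
      · obtain rfl : q = l := by simpa using hl
        refine ⟨hq, ?_⟩
        simp only [Cut.val, ATR.receive]
        ring
      · exact h.cuts_touch κ hκ l hl }

theorem RadiusIncrease.bounds {s : State n T} {q : ℕ} {d : ℝ} (h : RadiusIncrease D P s q d)
    (hle : s.Δcurr ≤ P.Δhi) : s.Δcurr ≤ d ∧ d ≤ P.Δhi := by
  have hmax : s.Δcurr ≤ max s.Δcurr (min P.Δhi (2 * s.Δ q)) ∧
      max s.Δcurr (min P.Δhi (2 * s.Δ q)) ≤ P.Δhi :=
    ⟨le_max_left _ _, max_le hle (min_le_left _ _)⟩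
  unfold RadiusIncrease at h
  split at h
  · split_ifs at h
    · rw [h]; exact hmax
    · rw [h]; exact ⟨le_rfl, hle⟩
  · rcases h with h | ⟨-, h⟩
    · rw [h]; exact ⟨le_rfl, hle⟩
    · rw [h]; exact hmax

theorem Core.install (hD : D.Regular Qs C β) {s s' : State n T} (h : Core D P Qs C β r₀ s) {q : ℕ}
    (hq : q ≤ s.k) (hacc : Accept D P s q) (hs' : Install D P s q s') :
    Core D P Qs C β r₀ s' := by
  obtain ⟨d, S, hd, hS, -, rfl⟩ := hs'
  obtain ⟨hd1, hd2⟩ := hd.bounds h.curr_le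
  exact
  { h with
    inc_le := by rintro i hi; obtain rfl : q = i := by simpa using hi
                 exact hq
    cuts_fin := h.cuts_fin.subset hS
    cuts_minorant := fun κ hκ => h.cuts_minorant κ (hS hκ)
    cuts_touch := fun κ hκ => h.cuts_touch κ (hS hκ)
    curr_pos := h.curr_pos.trans_le hd1
    curr_le := hd2
    parent_inc := by
      intro q' hq' i hi
      obtain ⟨i', hi', hle⟩ := h.parent_inc q' hq' i hi
      exact ⟨q, rfl, (hacc.1 i' hi').le.trans hle⟩
    curr_none := by intro hn; simp at hn
    curr_some := by
      intro i hi
      obtain rfl : q = i := by simpa using hi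
      -- The radius does not shrink here and the gap of the new incumbent is smaller, so the old
      -- bound suffices.
      refine le_trans ?_ hd1
      rcases hinc : s.inc with _ | i
      · exact (min_le_left _ _).trans (h.curr_none hinc)
      · refine le_trans ?_ (h.curr_some i hinc)
        have := (hacc.1 i hinc).le
        have hβ := hD.β_pos
        dsimp only
        gcongr
    accepted := by
      intro q' i hi hp
      obtain rfl : q = q' := by simpa using hi
      exact hacc.2 i hp }

/-- A reduction needs ρ > 1, and ρ times the predicted decrease G is at most min(1, Δ) β Δ. If G is
at least the gap of the parent, the factor 1 gives Δ/ρ ≥ gap/β; if G ≥ Δ/C, the factor Δ gives Δ/ρ ≥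
1/(βC) ≥ r₀. The gap of the present incumbent does not exceed that of the parent. -/
theorem reduceDelta_bounds (hD : D.Regular Qs C β) (hr₀ : r₀ ≤ 1 / (β * C)) {s : State n T}
    (h : Core D P Qs C β r₀ s) {q : ℕ} (hq : q ≤ s.k) :
    (reduceDelta D s q).1 ≤ s.Δcurr ∧ 0 < (reduceDelta D s q).1 ∧
      (s.inc = none → r₀ ≤ (reduceDelta D s q).1) ∧
      ∀ i, s.inc = some i → min r₀ ((D.Q (s.x i) - Qs) / β) ≤ (reduceDelta D s q).1 := by
  have triv : s.Δcurr ≤ s.Δcurr ∧ 0 < s.Δcurr ∧ (s.inc = none → r₀ ≤ s.Δcurr) ∧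
      ∀ i, s.inc = some i → min r₀ ((D.Q (s.x i) - Qs) / β) ≤ s.Δcurr :=
    ⟨le_rfl, h.curr_pos, h.curr_none, h.curr_some⟩
  unfold reduceDelta
  split
  · exact triv
  rename_i i hi
  dsimp only
  set ρ := rho D s q i with hρ
  have hβ := hD.β_pos
  have hC := hD.C_pos
  have hΔ := h.radius_pos q hq
  have hxi : s.x i ∈ D.feasible := h.x_feas i ((h.parent_lt q hq i hi).le.trans hq)
  obtain ⟨i', hi', hle⟩ := h.parent_inc q hq i hi
  have main : 1 < ρ → min s.Δcurr (s.Δ q / min ρ 4) ≤ s.Δcurr ∧ 0 < min s.Δcurr (s.Δ q / min ρ 4) ∧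
      (s.inc = none → r₀ ≤ min s.Δcurr (s.Δ q / min ρ 4)) ∧
      ∀ i, s.inc = some i →
        min r₀ ((D.Q (s.x i) - Qs) / β) ≤ min s.Δcurr (s.Δ q / min ρ 4) := by
    intro h1
    have hρ0 : 0 < ρ := one_pos.trans h1
    have hmin4 : 0 < min ρ 4 := lt_min hρ0 (by norm_num)
    refine ⟨min_le_left _ _, lt_min h.curr_pos (div_pos hΔ hmin4), fun hn => ?_, fun l hl => ?_⟩
    · rw [hi'] at hn; simp at hn
    · obtain rfl : i' = l := by rw [hi'] at hl; simpa using hl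
      refine le_min (h.curr_some i' hi') ?_
      have step1 : s.Δ q / ρ ≤ s.Δ q / min ρ 4 := by
        gcongr
        exact min_le_left _ _
      refine le_trans ?_ step1
      rw [le_div_iff₀ hρ0]
      have hgap := h.gap q hq i hi
      set G := D.Q (s.x i) - s.mval q with hG
      have hδ : 0 ≤ D.Q (s.x i) - Qs := sub_nonneg.2 (hD.lower _ hxi)
      have hG0 : 0 ≤ G := le_trans (le_min hδ (by positivity)) hgap
      -- A zero denominator makes ρ = 0 by convention, so no reduction occurs.
      have hGne : G ≠ 0 := by
        intro h0
        rw [hρ, rho, ← hG, h0, div_zero, mul_zero] at h1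
        linarith
      have hGpos : 0 < G := lt_of_le_of_ne hG0 hGne.symm
      have hprod : ρ * G = min 1 (s.Δ q) * (D.Q (s.x q) - D.Q (s.x i)) := by
        rw [hρ, rho, ← hG]
        field_simp
      have hlip : D.Q (s.x q) - D.Q (s.x i) ≤ β * s.Δ q := by
        have h1 := hD.lipschitz (s.x i) (s.x q)
        have h2 := mul_le_mul_of_nonneg_left (h.trust q hq i hi) hβ.le
        linarith
      have hm0 : 0 < min 1 (s.Δ q) := lt_min one_pos hΔ
      have hρG : ρ * G ≤ min 1 (s.Δ q) * (β * s.Δ q) := by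
        rw [hprod]
        gcongr
      rcases min_le_iff.1 hgap with hg | hg
      · have h3 : ρ * (D.Q (s.x i') - Qs) ≤ β * s.Δ q := by
          calc ρ * (D.Q (s.x i') - Qs) ≤ ρ * G := by gcongr; linarith
            _ ≤ min 1 (s.Δ q) * (β * s.Δ q) := hρG
            _ ≤ 1 * (β * s.Δ q) := by gcongr; exact min_le_left _ _
            _ = _ := one_mul _
        calc min r₀ ((D.Q (s.x i') - Qs) / β) * ρ ≤ ((D.Q (s.x i') - Qs) / β) * ρ := by
              gcongr
              exact min_le_right _ _
          _ = (ρ * (D.Q (s.x i') - Qs)) / β := by ring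
          _ ≤ s.Δ q := by rw [div_le_iff₀ hβ]; linarith
      · have h3 : ρ * (s.Δ q / C) ≤ s.Δ q * (β * s.Δ q) := by
          calc ρ * (s.Δ q / C) ≤ ρ * G := by gcongr
            _ ≤ min 1 (s.Δ q) * (β * s.Δ q) := hρG
            _ ≤ s.Δ q * (β * s.Δ q) := by gcongr; exact min_le_right _ _
        have h4 : ρ / C ≤ β * s.Δ q := by
          refine le_of_mul_le_mul_left ?_ hΔ
          calc s.Δ q * (ρ / C) = ρ * (s.Δ q / C) := by ring
            _ ≤ _ := h3
        calc min r₀ ((D.Q (s.x i') - Qs) / β) * ρ ≤ (1 / (β * C)) * ρ := by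
              gcongr
              exact (min_le_left _ _).trans hr₀
          _ = (ρ / C) / β := by field_simp
          _ ≤ s.Δ q := by rw [div_le_iff₀ hβ]; linarith
  split_ifs with hc hd
  · exact main (by rcases hd with hd | hd; linarith; exact hd.2.1)
  · exact triv
  · exact main (by rename_i hd; rcases hd with hd | hd; linarith; exact hd.2.1)
  · exact triv

theorem Core.reject (hD : D.Regular Qs C β) (hr₀ : r₀ ≤ 1 / (β * C)) {s s' : State n T}
    (h : Core D P Qs C β r₀ s) {q : ℕ} (hq : q ≤ s.k) (hs' : Reject D P s q s') :
    Core D P Qs C β r₀ s' := by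
  obtain ⟨S, hS, rfl⟩ := hs'
  obtain ⟨h1, h2, h3, h4⟩ := reduceDelta_bounds hD hr₀ h hq
  exact
  { h with
    cuts_fin := h.cuts_fin.subset hS.1
    cuts_minorant := fun κ hκ => h.cuts_minorant κ (hS.1 hκ)
    cuts_touch := fun κ hκ => h.cuts_touch κ (hS.1 hκ)
    curr_pos := h2
    curr_le := h1.trans h.curr_le
    curr_none := h3
    curr_some := h4 }

theorem Core.record (hD : D.Regular Qs C β) {s : State n T} (h : Core D P Qs C β r₀ s)
    {y : Fin n → ℝ} {θ : Fin T → ℝ}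
    (hsol : SubSolution D s.cuts (s.point s.inc) s.Δcurr y θ) :
    Core D P Qs C β r₀ (record D s y θ) := by
  have hlt : ∀ q ≤ s.k, q ≠ s.k + 1 := fun q hq => by omega
  have hcase : ∀ q, q ≤ s.k + 1 → q = s.k + 1 ∨ q ≤ s.k := fun q hq => by omega
  have hxi : ∀ i, s.inc = some i → Function.update s.x (s.k + 1) y i = s.x i := fun i hi =>
    Function.update_of_ne (hlt i (h.inc_le i hi)) _ _
  have hpt : ∀ i, s.inc = some i → s.point s.inc = s.x i := fun i hi => by rw [hi]; rfl
  have hxold : ∀ q ≤ s.k, Function.update s.x (s.k + 1) y q = s.x q := fun q hq =>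
    Function.update_of_ne (hlt q hq) _ _
  have hxpar : ∀ q ≤ s.k, ∀ i, s.parent q = some i →
      Function.update s.x (s.k + 1) y i = s.x i := fun q hq i hi =>
    hxold i ((h.parent_lt q hq i hi).le.trans hq)
  refine
  { x_feas := ?_, inc_le := ?_, parent_lt := ?_, cuts_fin := h.cuts_fin,
    cuts_minorant := h.cuts_minorant, cuts_touch := ?_, radius_pos := ?_, radius_le := ?_,
    curr_pos := h.curr_pos, curr_le := h.curr_le, parent_inc := ?_, trust := ?_, gap := ?_,
    curr_none := h.curr_none, curr_some := ?_, radius_ge := ?_, accepted := ?_,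
    active_opt := ?_ } <;> simp only [ATR.record]
  · intro q hq
    rcases hcase q hq with rfl | hq
    · rw [Function.update_self]; exact hsol.1.2.1
    · rw [hxold q hq]; exact h.x_feas q hq
  · intro i hi
    exact (h.inc_le i hi).trans (Nat.le_succ _)
  · intro q hq i hi
    rcases hcase q hq with rfl | hq
    · rw [Function.update_self] at hi
      exact Nat.lt_succ_of_le (h.inc_le i hi)
    · rw [Function.update_of_ne (hlt q hq)] at hi
      exact h.parent_lt q hq i hi
  · intro κ hκ l hl
    obtain ⟨h1, h2⟩ := h.cuts_touch κ hκ l hl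
    rw [hxold l h1]
    exact ⟨h1.trans (Nat.le_succ _), h2⟩
  · intro q hq
    rcases hcase q hq with rfl | hq
    · rw [Function.update_self]; exact h.curr_pos
    · rw [Function.update_of_ne (hlt q hq)]; exact h.radius_pos q hq
  · intro q hq
    rcases hcase q hq with rfl | hq
    · rw [Function.update_self]; exact h.curr_le
    · rw [Function.update_of_ne (hlt q hq)]; exact h.radius_le q hq
  · intro q hq i hi
    rcases hcase q hq with rfl | hq
    · rw [Function.update_self] at hi
      exact ⟨i, hi, le_rfl⟩
    · rw [Function.update_of_ne (hlt q hq)] at hi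
      obtain ⟨i', h1, h2⟩ := h.parent_inc q hq i hi
      refine ⟨i', h1, ?_⟩
      rwa [hxi i' h1, hxpar q hq i hi]
  · intro q hq i hi
    rcases hcase q hq with rfl | hq
    · rw [Function.update_self] at hi
      rw [Function.update_self, Function.update_self, hxi i hi, ← hpt i hi]
      exact hsol.1.2.2
    · rw [Function.update_of_ne (hlt q hq)] at hi
      rw [hxold q hq, hxpar q hq i hi, Function.update_of_ne (hlt q hq)]
      exact h.trust q hq i hi
  · intro q hq i hi
    rcases hcase q hq with rfl | hq
    · rw [Function.update_self] at hi
      rw [Function.update_self, Function.update_self, hxi i hi]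
      rw [hpt i hi] at hsol
      exact hsol.gap hD h.cuts_minorant (h.x_feas i (h.inc_le i hi)) h.curr_pos
    · rw [Function.update_of_ne (hlt q hq)] at hi
      rw [hxpar q hq i hi, Function.update_of_ne (hlt q hq), Function.update_of_ne (hlt q hq)]
      exact h.gap q hq i hi
  · intro i hi
    rw [hxi i hi]
    exact h.curr_some i hi
  · intro q hq i hi
    rcases hcase q hq with rfl | hq
    · rw [Function.update_self] at hi
      rw [Function.update_self, hxi i hi]
      exact h.curr_some i hi
    · rw [Function.update_of_ne (hlt q hq)] at hi
      rw [hxpar q hq i hi, Function.update_of_ne (hlt q hq)]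
      exact h.radius_ge q hq i hi
  · intro q i hq hi
    have hqk := h.inc_le q hq
    rw [Function.update_of_ne (hlt q hqk)] at hi
    rw [hxold q hqk, hxpar q hqk i hi, Function.update_of_ne (hlt q hqk)]
    exact h.accepted q i hq hi
  · intro i hi y' θ' hf
    rw [Function.update_self] at hi
    rw [Function.update_self, hxi i hi, ← hpt i hi] at hf
    rw [Function.update_self]
    exact hsol.le_of_active h.cuts_fin hf

theorem Core.generate (hD : D.Regular Qs C β) {s s' : State n T} (h : Core D P Qs C β r₀ s)
    (hg : Generate D P s s') : Core D P Qs C β r₀ s' := by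
  obtain ⟨y, θ, hsol, ⟨-, rfl⟩ | ⟨-, rfl⟩⟩ := hg
  · exact { h.record hD hsol with }
  · exact { h.record hD hsol with }

end ATR

/-! ### Task bookkeeping and the effect of one step. -/

namespace ATR

variable {n r n₂ r₂ N T : ℕ} {D : TwoStageLP n r n₂ r₂ N T} {P : Params n T} {Qs C β r₀ : ℝ}

/-- A fully evaluated iterate `x^q` is no better than the incumbent, or its decrease was
insufficient. -/
def Judged (D : TwoStageLP n r n₂ r₂ N T) (P : Params n T) (s : State n T) (q : ℕ) : Prop :=
  (∃ i, s.inc = some i ∧ D.Q (s.x i) ≤ D.Q (s.x q)) ∨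
    ∃ p, s.parent q = some p ∧
      D.Q (s.x p) - P.ξ * (D.Q (s.x p) - s.mval q) < D.Q (s.x q)

/-- Bookkeeping of the tasks while the algorithm is running. -/
structure Tasks (D : TwoStageLP n r n₂ r₂ N T) (P : Params n T) (s : State n T) : Prop where
  pending_le : ∀ q j, (q, j) ∈ s.pending → q ≤ s.k
  count : ∀ q ≤ s.k, s.t q + (Finset.univ.filter fun j => (q, j) ∈ s.pending).card = T
  judged : ∀ q ≤ s.k, (∀ j, (q, j) ∉ s.pending) → Judged D P s q

/-- The radius and the active cuts of the latest subproblem bound the present ones. -/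
structure Fresh (s : State n T) : Prop where
  radius : s.Δcurr ≤ s.Δ s.k
  active : s.active ⊆ s.cuts

/-- `u` is the state reached from `s` after the completion of task `(q, j)` and before the
generation of a new iterate. -/
structure Mid (D : TwoStageLP n r n₂ r₂ N T) (P : Params n T) (s : State n T) (q : ℕ) (j : Fin T)
    (u : State n T) : Prop where
  k : u.k = s.k
  x : u.x = s.x
  parent : u.parent = s.parent
  Δ : u.Δ = s.Δ
  mval : u.mval = s.mval
  active : u.active = s.active
  stopped : u.stopped = s.stopped
  pending : u.pending = s.pending.erase (q, j)
  t : u.t = Function.update s.t q (s.t q + 1)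
  inc : u.inc = s.inc ∨ (u.inc = some q ∧ ∀ i, s.inc = some i → D.Q (s.x q) < D.Q (s.x i))
  judged : u.t q = T → Judged D P u q
  keep : ∀ i, s.inc = some i → u.inc = some i → u.Δcurr ≤ s.Δcurr ∧
    ∃ κ₀ : Cut n T, κ₀.origin = some q ∧ κ₀.cluster = j ∧
      ∀ κ, (κ ∈ s.cuts ∨ κ = κ₀) → Protected D P s κ → κ ∈ u.cuts

/-- Separates the reaction to a result from the generation of an iterate. Acceptance strictly lowers
the incumbent value, so `keep` is vacuous there; in the other branches the radius cannot grow and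
protected cuts survive. -/
theorem Step.exists_mid (hD : D.Regular Qs C β) (hr₀ : r₀ ≤ 1 / (β * C)) {s s' : State n T}
    (h : Core D P Qs C β r₀ s) (hpend : ∀ q j, (q, j) ∈ s.pending → q ≤ s.k)
    (hs : Step D P s s') :
    ∃ q j u, (q, j) ∈ s.pending ∧ Core D P Qs C β r₀ u ∧ Mid D P s q j u ∧
      (Generate D P u s' ∨ (s' = u ∧ u.Δcurr = s.Δcurr ∧ s.cuts ⊆ u.cuts)) := by
  obtain ⟨q, j, g, hqj, hg, hr⟩ := hs
  have hq := hpend q j hqj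
  have h1 := h.receive hq hg
  rcases hr with ⟨ht, u, ⟨hacc, hu⟩ | ⟨hacc, hu⟩, hgen⟩ | ⟨ht, -, hgen⟩ | ⟨ht, -, rfl⟩
  · have h2 := h1.install hD hq hacc hu
    obtain ⟨d, S, hd, hS, -, rfl⟩ := hu
    refine ⟨q, j, _, hqj, ?_, ?_, .inl hgen⟩
    · exact { h2 with }
    refine ⟨rfl, rfl, rfl, rfl, rfl, rfl, rfl, rfl, rfl, .inr ⟨rfl, hacc.1⟩,
      fun _ => .inl ⟨q, rfl, le_rfl⟩, fun i hi hu => ?_⟩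
    obtain rfl : q = i := by simpa using hu
    exact absurd (hacc.1 q hi) (lt_irrefl _)
  · have h2 := h1.reject hD hr₀ hq hu
    obtain ⟨S, hS, rfl⟩ := hu
    refine ⟨q, j, _, hqj, ?_, ?_, .inl hgen⟩
    · exact { h2 with }
    refine ⟨rfl, rfl, rfl, rfl, rfl, rfl, rfl, rfl, rfl, .inl rfl,
      fun _ => ?_, fun i hi hu => ⟨(reduceDelta_bounds hD hr₀ h1 hq).1, _, rfl, rfl,
        fun κ hκ hp => hS.2 κ (hκ.elim Or.inr Or.inl) hp⟩⟩
    rw [Accept, not_and_or] at hacc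
    push Not at hacc
    exact hacc
  · refine ⟨q, j, _, hqj, ?_, ?_, .inl hgen⟩
    · exact { h1 with }
    exact ⟨rfl, rfl, rfl, rfl, rfl, rfl, rfl, rfl, rfl, .inl rfl,
      fun h => absurd h ht, fun i hi hu => ⟨le_rfl, _, rfl, rfl,
        fun κ hκ hp => hκ.elim Or.inr Or.inl⟩⟩
  · refine ⟨q, j, _, hqj, h1, ?_, .inr ⟨rfl, rfl, Set.subset_insert _ _⟩⟩
    exact ⟨rfl, rfl, rfl, rfl, rfl, rfl, rfl, rfl, rfl, .inl rfl,
      fun h => absurd h ht, fun i hi hu => ⟨le_rfl, _, rfl, rfl,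
        fun κ hκ hp => hκ.elim Or.inr Or.inl⟩⟩

/-- What the generation of an iterate does to the state. -/
structure Generated (D : TwoStageLP n r n₂ r₂ N T) (P : Params n T) (u s' : State n T) : Prop where
  k : s'.k = u.k + 1
  x : ∀ q ≤ u.k, s'.x q = u.x q
  parent : ∀ q ≤ u.k, s'.parent q = u.parent q
  Δ : ∀ q ≤ u.k, s'.Δ q = u.Δ q
  mval : ∀ q ≤ u.k, s'.mval q = u.mval q
  inc : s'.inc = u.inc
  Δcurr : s'.Δcurr = u.Δcurr
  cuts : s'.cuts = u.cuts
  parent_new : s'.parent (u.k + 1) = u.inc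
  Δ_new : s'.Δ (u.k + 1) = u.Δcurr
  sol : ∃ θ, SubFeasible D u.cuts (u.point u.inc) u.Δcurr (s'.x (u.k + 1)) θ ∧
    s'.mval (u.k + 1) = subObj D (s'.x (u.k + 1)) θ
  active : s'.active ⊆ s'.cuts
  halting : s'.stopped → u.stopped ∨ ConvTest D P s'
  pending_old : ∀ q ≤ u.k, ∀ j, (q, j) ∈ s'.pending → (q, j) ∈ u.pending
  running : ¬ s'.stopped → s'.pending = u.pending ∪ ({u.k + 1} ×ˢ Finset.univ) ∧
    s'.t = Function.update u.t (u.k + 1) 0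

theorem Generate.generated {u s' : State n T} (hg : Generate D P u s') : Generated D P u s' := by
  have hlt : ∀ q ≤ u.k, q ≠ u.k + 1 := fun q hq => by omega
  have hne : ∀ {α : Type} (f : ℕ → α) (a : α), ∀ q ≤ u.k,
      Function.update f (u.k + 1) a q = f q := fun f a q hq => Function.update_of_ne (hlt q hq) _ _
  have hx : ∀ a, ∀ q ≤ u.k, Function.update u.x (u.k + 1) a q = u.x q :=
    fun a q hq => Function.update_of_ne (hlt q hq) _ _
  obtain ⟨y, θ, hsol, ⟨hc, rfl⟩ | ⟨-, rfl⟩⟩ := hg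
  · refine ⟨rfl, hx _, hne _ _, hne _ _, hne _ _, rfl, rfl, rfl, Function.update_self _ _ _,
      Function.update_self _ _ _, ⟨θ, ?_, ?_⟩, fun κ hκ => hκ.1, fun _ => .inr hc,
      fun q _ j h => h, fun h => absurd trivial h⟩
    · simpa [record] using hsol.1
    · simp [record]
  · refine ⟨rfl, hx _, hne _ _, hne _ _, hne _ _, rfl, rfl, rfl, Function.update_self _ _ _,
      Function.update_self _ _ _, ⟨θ, ?_, ?_⟩, fun κ hκ => hκ.1, fun h => .inl h,
      fun q hq j h => ?_, fun h => ⟨rfl, rfl⟩⟩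
    · simpa [record, issue] using hsol.1
    · simp [record, issue]
    · simp only [issue, record, Finset.mem_union, Finset.mem_product, Finset.mem_singleton,
        Finset.mem_univ, and_true] at h
      exact h.resolve_right (hlt q hq)

/-- Either task `(l, j)` is pending or a cut that it returned is in the model. -/
def HasCut (s : State n T) (l : ℕ) (j : Fin T) : Prop :=
  (l, j) ∈ s.pending ∨ ∃ κ ∈ s.cuts, κ.origin = some l ∧ κ.cluster = j

/-- The effect of one step on the data that matter for convergence. -/
structure Transition (D : TwoStageLP n r n₂ r₂ N T) (P : Params n T) (s s' : State n T) :
    Prop where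
  k : s'.k = s.k ∨ s'.k = s.k + 1
  x : ∀ q ≤ s.k, s'.x q = s.x q
  parent : ∀ q ≤ s.k, s'.parent q = s.parent q
  Δ : ∀ q ≤ s.k, s'.Δ q = s.Δ q
  mval : ∀ q ≤ s.k, s'.mval q = s.mval q
  inc : s'.inc = s.inc ∨
    ∃ q ≤ s.k, s'.inc = some q ∧ ∀ i, s.inc = some i → D.Q (s.x q) < D.Q (s.x i)
  parent_new : s'.k = s.k + 1 → s'.parent (s.k + 1) = s'.inc
  sol : s'.k = s.k + 1 → ∃ θ, (∀ κ ∈ s'.cuts, κ.val (s'.x (s.k + 1)) ≤ θ κ.cluster) ∧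
    s'.mval (s.k + 1) = subObj D (s'.x (s.k + 1)) θ
  fresh : Fresh s'
  halting : s'.stopped → ConvTest D P s' ∧ s'.parent s'.k = s'.inc
  pending_old : ∀ q ≤ s.k, ∀ j, (q, j) ∈ s'.pending → (q, j) ∈ s.pending
  pending_new : ¬ s'.stopped → s'.k = s.k + 1 → ∀ j, (s.k + 1, j) ∈ s'.pending
  card : ¬ s'.stopped → s'.pending.card + 1 + T * s.k = s.pending.card + T * s'.k
  mono : ∀ i, s.inc = some i → s'.inc = some i → s.parent s.k = some i → s'.k = s.k + 1 →
    s.mval s.k ≤ s'.mval (s.k + 1)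
  keep : ∀ i, s.inc = some i → s'.inc = some i → s.parent s.k = some i →
    ∀ l ≤ s.k, s.parent l = some i →
    P.η * (D.Q (s.x i) - s.mval l) < D.Q (s.x i) - s.mval s.k →
    ∀ j, HasCut s l j → ¬ s'.stopped → HasCut s' l j

theorem Mid.count {s u : State n T} {q : ℕ} {j : Fin T} (hm : Mid D P s q j u)
    (ht : Tasks D P s) (hqj : (q, j) ∈ s.pending) :
    ∀ q' ≤ s.k, u.t q' + (Finset.univ.filter fun j' => (q', j') ∈ u.pending).card = T := by
  classical
  intro q' hq'
  refine Eq.trans ?_ (ht.count q' hq')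
  rw [hm.t, hm.pending]
  rcases eq_or_ne q' q with rfl | hne
  · have : (Finset.univ.filter fun j' => (q', j') ∈ s.pending.erase (q', j)) =
        (Finset.univ.filter fun j' => (q', j') ∈ s.pending).erase j := by
      ext j'
      simp [Finset.mem_erase]
    rw [this, Function.update_self]
    have hmem : j ∈ Finset.univ.filter fun j' => (q', j') ∈ s.pending := by simpa using hqj
    have := Finset.card_erase_add_one hmem
    omega
  · rw [Function.update_of_ne hne]
    congr 2
    ext j'
    simp [Finset.mem_erase, hne]

theorem Mid.tasks {s u : State n T} {q : ℕ} {j : Fin T}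
    (hm : Mid D P s q j u) (ht : Tasks D P s) (hqj : (q, j) ∈ s.pending) : Tasks D P u := by
  have hcount := hm.count ht hqj
  refine ⟨fun q' j' h => ?_, by rw [hm.k]; exact hcount, fun q' hq' h => ?_⟩
  · rw [hm.pending] at h
    rw [hm.k]
    exact ht.pending_le q' j' (Finset.mem_of_mem_erase h)
  · rw [hm.k] at hq'
    rcases eq_or_ne q' q with rfl | hne
    -- No pending task means t_q = T by the count, so this very completion triggered the acceptance
    -- test.
    · refine hm.judged ?_
      have := hcount q' hq'
      rwa [Finset.filter_false_of_mem (fun j' _ => h j'), Finset.card_empty, add_zero] at this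
    · have hold : ∀ j', (q', j') ∉ s.pending := fun j' hj' => h j' (by
        rw [hm.pending]
        exact Finset.mem_erase.2 ⟨fun e => hne (Prod.ext_iff.1 e).1, hj'⟩)
      -- An earlier verdict persists because incumbents only improve.
      rcases ht.judged q' hq' hold with ⟨i, hi, hle⟩ | hp
      · left
        rw [hm.x]
        rcases hm.inc with he | ⟨he, hlt⟩
        · exact ⟨i, he.trans hi, hle⟩
        · exact ⟨q, he, (hlt i hi).le.trans hle⟩
      · right
        rwa [hm.x, hm.mval, hm.parent]

theorem Generated.tasks {u s' : State n T} (hT : 0 < T) (hg : Generated D P u s')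
    (hc : Core D P Qs C β r₀ u) (ht : Tasks D P u) (hrun : ¬ s'.stopped) : Tasks D P s' := by
  obtain ⟨hpend, htt⟩ := hg.running hrun
  have hmem : ∀ q j, (q, j) ∈ s'.pending ↔ (q, j) ∈ u.pending ∨ q = u.k + 1 := by
    intro q j
    simp [hpend, eq_comm]
  have hcase : ∀ q, q ≤ s'.k → q = u.k + 1 ∨ q ≤ u.k := fun q hq => by
    rw [hg.k] at hq; omega
  refine ⟨fun q j h => ?_, fun q hq => ?_, fun q hq h => ?_⟩
  · rw [hg.k]
    rcases (hmem q j).1 h with h | h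
    · exact (ht.pending_le q j h).trans (Nat.le_succ _)
    · exact h.le
  · rw [htt]
    rcases hcase q hq with rfl | hq
    · rw [Function.update_self, Finset.filter_true_of_mem (fun j _ => (hmem _ j).2 (.inr rfl))]
      simp
    · rw [Function.update_of_ne (by omega)]
      refine Eq.trans ?_ (ht.count q hq)
      congr 2
      ext j
      simp only [Finset.mem_filter, Finset.mem_univ, true_and, hmem]
      exact or_iff_left (by omega)
  · rcases hcase q hq with rfl | hq
    -- Since T > 0, the new iterate still has a pending task.
    · exact absurd ((hmem _ ⟨0, hT⟩).2 (.inr rfl)) (h _)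
    · rcases ht.judged q hq (fun j hj => h j ((hmem q j).2 (.inl hj))) with ⟨i, hi, hle⟩ | ⟨p, hp, hlt⟩
      · left
        refine ⟨i, hg.inc.trans hi, ?_⟩
        rwa [hg.x i (hc.inc_le i hi), hg.x q hq]
      · right
        refine ⟨p, (hg.parent q hq).trans hp, ?_⟩
        rwa [hg.x p ((hc.parent_lt q hq p hp).le.trans hq), hg.x q hq, hg.mval q hq]

theorem Step.transition (hT : 0 < T) (hD : D.Regular Qs C β) (hr₀ : r₀ ≤ 1 / (β * C))
    {s s' : State n T} (h : Core D P Qs C β r₀ s) (ht : Tasks D P s) (hf : Fresh s)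
    (hrun : ¬ s.stopped) (hs : Step D P s s') :
    Core D P Qs C β r₀ s' ∧ (¬ s'.stopped → Tasks D P s') ∧ Transition D P s s' := by
  obtain ⟨q, j, u, hqj, hu, hm, hgen⟩ := hs.exists_mid hD hr₀ h ht.pending_le
  have htu := hm.tasks ht hqj
  have hq := ht.pending_le q j hqj
  have hcard : u.pending.card + 1 = s.pending.card := by
    rw [hm.pending]
    exact Finset.card_erase_add_one hqj
  have hkeep : ∀ i, s.inc = some i → u.inc = some i → s.parent s.k = some i →
      ∀ l ≤ s.k, s.parent l = some i →
      P.η * (D.Q (s.x i) - s.mval l) < D.Q (s.x i) - s.mval s.k →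
      ∀ j, HasCut s l j → HasCut u l j := by
    intro i hi hi' hpk l hl hpl hη j' hcut
    obtain ⟨-, κ₀, ho, hcl, hκ⟩ := hm.keep i hi hi'
    have hprot : ∀ κ : Cut n T, κ.origin = some l → Protected D P s κ := fun κ hκ =>
      .inr (.inr ⟨l, i, hl, hκ, hpl, hpk, hη⟩)
    rcases hcut with hp | ⟨κ, hκs, hκo, hκc⟩
    · by_cases he : (l, j') = (q, j)
      · obtain ⟨rfl, rfl⟩ := Prod.ext_iff.1 he
        exact .inr ⟨κ₀, hκ κ₀ (.inr rfl) (hprot κ₀ ho), ho, hcl⟩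
      · left
        rw [hm.pending]
        exact Finset.mem_erase.2 ⟨he, hp⟩
    · exact .inr ⟨κ, hκ κ (.inl hκs) (hprot κ hκo), hκo, hκc⟩
  have hinc : u.inc = s.inc ∨
      ∃ q ≤ s.k, u.inc = some q ∧ ∀ i, s.inc = some i → D.Q (s.x q) < D.Q (s.x i) :=
    hm.inc.imp_right fun h => ⟨q, hq, h⟩
  rcases hgen with hgen | ⟨rfl, hΔ, hcuts⟩
  · have hg := hgen.generated
    have hk : s'.k = s.k + 1 := by rw [hg.k, hm.k]
    refine ⟨hu.generate hD hgen, hg.tasks hT hu htu, ?_⟩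
    have hle : ∀ q ≤ s.k, q ≤ u.k := fun q hq => by rwa [hm.k]
    have hsol := hg.sol
    rw [hm.k] at hsol
    constructor
    · exact .inr hk
    · intro q hq; rw [hg.x q (hle q hq), hm.x]
    · intro q hq; rw [hg.parent q (hle q hq), hm.parent]
    · intro q hq; rw [hg.Δ q (hle q hq), hm.Δ]
    · intro q hq; rw [hg.mval q (hle q hq), hm.mval]
    · rw [hg.inc]; exact hinc
    · intro _; rw [hg.inc, ← hm.k]; exact hg.parent_new
    · intro _
      obtain ⟨θ, hθ, hv⟩ := hsol
      rw [hg.cuts]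
      exact ⟨θ, hθ.1, hv⟩
    -- Acceptance may have enlarged the radius, but the iterate just generated uses that same
    -- radius.
    · refine ⟨?_, hg.active⟩
      rw [hg.Δcurr, hg.k, hg.Δ_new]
    · intro hst
      refine ⟨(hg.halting hst).resolve_left (by rwa [hm.stopped]), ?_⟩
      rw [hg.k, hg.parent_new, hg.inc]
    · intro q hq j' hj'
      have := hg.pending_old q (hle q hq) j' hj'
      rw [hm.pending] at this
      exact Finset.mem_of_mem_erase this
    · intro hr _ j'
      rw [(hg.running hr).1, hm.k]
      simp
    · intro hr
      rw [(hg.running hr).1, Finset.card_union_of_disjoint, Finset.card_product, hk]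
      · simp only [Finset.card_singleton, Finset.card_univ, Fintype.card_fin]
        rw [← hcard]
        ring
      · rw [Finset.disjoint_left]
        rintro ⟨a, b⟩ ha hb
        have h1 := htu.pending_le a b ha
        simp only [Finset.mem_product, Finset.mem_singleton] at hb
        omega
    · intro i hi hi' hpk _
      rw [hg.inc] at hi'
      obtain ⟨θ, hθ, hv⟩ := hsol
      obtain ⟨hΔ, κ₀, -, -, hκ⟩ := hm.keep i hi hi'
      rw [hv]
      -- The new solution satisfies the cuts active at the previous one and lies within the previous
      -- radius of the same centre, so it competes in the relaxed subproblem.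
      refine h.active_opt i hpk _ _ ⟨fun κ hκa => ?_, hθ.2.1, ?_⟩
      · exact hθ.1 κ (hκ κ (.inl (hf.active hκa)) (.inr (.inl hκa)))
      · have := hθ.2.2
        rw [hi'] at this
        simp only [State.point, hm.x] at this
        exact this.trans (hΔ.trans hf.radius)
    · intro i hi hi' hpk l hl hpl hη j' hcut hr
      rw [hg.inc] at hi'
      rcases hkeep i hi hi' hpk l hl hpl hη j' hcut with hp | ⟨κ, hκ, ho⟩
      · left
        rw [(hg.running hr).1]
        exact Finset.mem_union_left _ hp
      · right
        rw [hg.cuts]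
        exact ⟨κ, hκ, ho⟩
  · have hk : s'.k ≠ s.k + 1 := by rw [hm.k]; omega
    refine ⟨hu, fun _ => htu, ?_⟩
    constructor
    · exact .inl hm.k
    · intro q hq; rw [hm.x]
    · intro q hq; rw [hm.parent]
    · intro q hq; rw [hm.Δ]
    · intro q hq; rw [hm.mval]
    · exact hinc
    · intro h; exact absurd h hk
    · intro h; exact absurd h hk
    · refine ⟨?_, ?_⟩
      · rw [hΔ, hm.Δ, hm.k]; exact hf.radius
      · rw [hm.active]; exact hf.active.trans hcuts
    · intro h; rw [hm.stopped] at h; exact absurd h hrun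
    · intro q hq j' hj'
      rw [hm.pending] at hj'
      exact Finset.mem_of_mem_erase hj'
    · intro _ h; exact absurd h hk
    · intro _; rw [hm.k, hcard]
    · intro _ _ _ _ h; exact absurd h hk
    · intro i h1 h2 h3 l h4 h5 h6 j' h7 _
      exact hkeep i h1 h2 h3 l h4 h5 h6 j' h7

theorem Initial.tasks (hT : 0 < T) {s : State n T} (h : Initial P s) : Tasks D P s := by
  have hmem : ∀ q j, (q, j) ∈ s.pending ↔ q = 0 := by
    intro q j
    simp [h.pending, eq_comm]
  refine ⟨fun q j hq => ?_, fun q hq => ?_, fun q hq hno => ?_⟩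
  · rw [(hmem q j).1 hq]; exact Nat.zero_le _
  · obtain rfl : q = 0 := by rw [h.k] at hq; omega
    rw [h.t, Finset.filter_true_of_mem (fun j _ => (hmem _ j).2 rfl)]
    simp
  · obtain rfl : q = 0 := by rw [h.k] at hq; omega
    exact absurd ((hmem 0 ⟨0, hT⟩).2 rfl) (hno _)

theorem Initial.fresh {s : State n T} (h : Initial P s) : Fresh s := by
  refine ⟨?_, ?_⟩
  · rw [h.k, h.Δ, h.Δcurr]
  · rw [h.active]; exact Set.empty_subset _

end ATR

/-! ### Convergence along an infinite execution. -/

namespace ATR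

variable {n r n₂ r₂ N T : ℕ} {D : TwoStageLP n r n₂ r₂ N T} {P : Params n T} {Qs C β r₀ : ℝ}
  {s : ℕ → State n T}

/-- `Tasks` is claimed only while the algorithm runs: the iterate recorded on termination is issued
no tasks. -/
theorem IsRun.invariant (hT : 0 < T) (hD : D.Regular Qs C β) (hP : P.Admissible D)
    (hr₁ : r₀ ≤ P.Δinit) (hr₀ : r₀ ≤ 1 / (β * C)) (hs : IsRun D P s) (e : ℕ) :
    Core D P Qs C β r₀ (s e) ∧ Fresh (s e) ∧ (¬ (s e).stopped → Tasks D P (s e)) ∧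
      ((s e).stopped → ConvTest D P (s e) ∧ (s e).parent (s e).k = (s e).inc) := by
  induction e with
  | zero =>
    exact ⟨Core.initial hP hr₁ hs.init, hs.init.fresh, fun _ => hs.init.tasks hT,
      fun h => absurd h hs.init.stopped⟩
  | succ e ih =>
    by_cases hst : (s e).stopped
    · rw [hs.halted e hst]
      exact ih
    · obtain ⟨h1, h2, h3⟩ := (hs.step e hst).transition hT hD hr₀ ih.1 (ih.2.2.1 hst) ih.2.1 hst
      exact ⟨h1, h3.fresh, h2, h3.halting⟩

/-- If the algorithm stops with zero tolerance, then the incumbent is optimal. -/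
theorem Core.optimal_of_convTest (hD : D.Regular Qs C β) (htol : P.tol = 0) {s : State n T}
    (h : Core D P Qs C β r₀ s) (hc : ConvTest D P s) (hp : s.parent s.k = s.inc) :
    ∃ i, s.inc = some i ∧ s.x i ∈ D.feasible ∧ D.Q (s.x i) ≤ Qs := by
  obtain ⟨i, hi, hle⟩ := hc
  refine ⟨i, hi, h.x_feas i (h.inc_le i hi), ?_⟩
  rw [htol, zero_mul] at hle
  -- With zero tolerance min(gap, Δ/C) ≤ 0, and Δ/C is positive.
  have hgap := (h.gap s.k le_rfl i (hp.trans hi)).trans hle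
  rcases min_le_iff.1 hgap with h1 | h1
  · linarith
  · exact absurd h1 (not_le.2 (div_pos (h.radius_pos _ le_rfl) hD.C_pos))

/-- An execution that never stops, with its iterates `X`, parent incumbents `I`, radii `R` and
model values `M`. -/
structure Trajectory (D : TwoStageLP n r n₂ r₂ N T) (P : Params n T) (Qs C β r₀ : ℝ)
    (s : ℕ → State n T) (X : ℕ → Fin n → ℝ) (I : ℕ → Option ℕ) (R M : ℕ → ℝ) : Prop where
  core : ∀ e, Core D P Qs C β r₀ (s e)
  running : ∀ e, ¬ (s e).stopped
  tasks : ∀ e, Tasks D P (s e)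
  trans : ∀ e, Transition D P (s e) (s (e + 1))
  x : ∀ e, ∀ q ≤ (s e).k, (s e).x q = X q
  parent : ∀ e, ∀ q ≤ (s e).k, (s e).parent q = I q
  Δ : ∀ e, ∀ q ≤ (s e).k, (s e).Δ q = R q
  mval : ∀ e, ∀ q ≤ (s e).k, (s e).mval q = M q
  mono : Monotone fun e => (s e).k
  unbounded : ∀ k, ∃ e, k ≤ (s e).k
  zero : (s 0).k = 0
  root : I 0 = none
  done : ∀ q, ∃ e, q ≤ (s e).k ∧ ∀ e', e ≤ e' → ∀ j, (q, j) ∉ (s e').pending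

theorem IsRun.exists_trajectory (hT : 0 < T) (hD : D.Regular Qs C β) (hP : P.Admissible D)
    (hr₁ : r₀ ≤ P.Δinit) (hr₀ : r₀ ≤ 1 / (β * C)) (hs : IsRun D P s)
    (hrun : ∀ e, ¬ (s e).stopped) :
    ∃ X I R M, Trajectory D P Qs C β r₀ s X I R M := by
  have hinv := hs.invariant hT hD hP hr₁ hr₀
  have htr : ∀ e, Transition D P (s e) (s (e + 1)) := fun e =>
    ((hs.step e (hrun e)).transition hT hD hr₀ (hinv e).1 ((hinv e).2.2.1 (hrun e)) (hinv e).2.1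
      (hrun e)).2.2
  have hmono : Monotone fun e => (s e).k := monotone_nat_of_le_succ fun e => by
    rcases (htr e).k with h | h <;> omega
  have hstab : ∀ e d, ∀ q ≤ (s e).k, (s (e + d)).x q = (s e).x q ∧
      (s (e + d)).parent q = (s e).parent q ∧ (s (e + d)).Δ q = (s e).Δ q ∧
      (s (e + d)).mval q = (s e).mval q ∧ ∀ j, (q, j) ∈ (s (e + d)).pending → (q, j) ∈ (s e).pending := by
    intro e d q hq
    induction d with
    | zero => exact ⟨rfl, rfl, rfl, rfl, fun _ h => h⟩
    | succ d ih =>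
      have hq' : q ≤ (s (e + d)).k := hq.trans (hmono (Nat.le_add_right e d))
      have h := htr (e + d)
      exact ⟨(h.x q hq').trans ih.1, (h.parent q hq').trans ih.2.1, (h.Δ q hq').trans ih.2.2.1,
        (h.mval q hq').trans ih.2.2.2.1, fun j hj => ih.2.2.2.2 j (h.pending_old q hq' j hj)⟩
  -- Every event completes one task and every iterate issues T, so T(k + 1) completions require at
  -- least k + 1 iterates, counting x^0.
  have hcard : ∀ e, (s e).pending.card + e = T * ((s e).k + 1) := by
    intro e
    induction e with
    | zero => rw [hs.init.pending, hs.init.k]; simp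
    | succ e ih =>
      have := (htr e).card (hrun (e + 1))
      rw [mul_add] at *
      omega
  have hunb : ∀ k, ∃ e, k ≤ (s e).k := by
    intro k
    refine ⟨T * (k + 1), ?_⟩
    have := hcard (T * (k + 1))
    have h2 : T * (k + 1) ≤ T * ((s (T * (k + 1))).k + 1) := by omega
    have := Nat.le_of_mul_le_mul_left h2 hT
    omega
  choose ev hev using hunb
  have hglob : ∀ {α : Type} (f : State n T → ℕ → α),
      (∀ e d, ∀ q ≤ (s e).k, f (s (e + d)) q = f (s e) q) →
      ∀ e, ∀ q ≤ (s e).k, f (s e) q = f (s (ev q)) q := by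
    intro α f hf e q hq
    rcases le_total e (ev q) with h | h
    · obtain ⟨d, hd⟩ := Nat.exists_eq_add_of_le h
      rw [hd]
      exact (hf e d q hq).symm
    · obtain ⟨d, hd⟩ := Nat.exists_eq_add_of_le h
      rw [hd]
      exact hf (ev q) d q (hev q)
  refine ⟨fun q => (s (ev q)).x q, fun q => (s (ev q)).parent q, fun q => (s (ev q)).Δ q,
    fun q => (s (ev q)).mval q, fun e => (hinv e).1, hrun, fun e => (hinv e).2.2.1 (hrun e), htr,
    hglob State.x fun e d q hq => (hstab e d q hq).1,
    hglob State.parent fun e d q hq => (hstab e d q hq).2.1,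
    hglob State.Δ fun e d q hq => (hstab e d q hq).2.2.1,
    hglob State.mval fun e d q hq => (hstab e d q hq).2.2.2.1,
    hmono, fun k => ⟨ev k, hev k⟩, hs.init.k, ?_, ?_⟩
  · have := hglob State.parent (fun e d q hq => (hstab e d q hq).2.1) 0 0 (Nat.zero_le _)
    rw [← this]
    exact hs.init.parent
  · intro q
    have hj : ∀ j, ∃ e, ev q ≤ e ∧ (q, j) ∉ (s e).pending := by
      intro j
      by_cases hp : (q, j) ∈ (s (ev q)).pending
      · obtain ⟨e, he, h⟩ := hs.tasks_completed (ev q) _ hp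
        exact ⟨e, he, h.resolve_left (hrun e)⟩
      · exact ⟨ev q, le_rfl, hp⟩
    choose f hf1 hf2 using hj
    have hle : ∀ j, f j ≤ ev q + ∑ j, f j := fun j =>
      (Finset.single_le_sum (f := f) (fun _ _ => Nat.zero_le _) (Finset.mem_univ j)).trans
        (Nat.le_add_left _ _)
    refine ⟨ev q + ∑ j, f j, (hev q).trans (hmono (Nat.le_add_right _ _)), fun e' he' j hmem => ?_⟩
    obtain ⟨d, hd⟩ := Nat.exists_eq_add_of_le ((hle j).trans he')
    rw [hd] at hmem
    exact hf2 j ((hstab (f j) d q ((hev q).trans (hmono (hf1 j)))).2.2.2.2 j hmem)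

namespace Trajectory

variable {X : ℕ → Fin n → ℝ} {I : ℕ → Option ℕ} {R M : ℕ → ℝ}

theorem exists_generation (h : Trajectory D P Qs C β r₀ s X I R M) {E k : ℕ} (hk : (s E).k < k) :
    ∃ e, E ≤ e ∧ (s e).k + 1 = k ∧ (s (e + 1)).k = k := by
  classical
  have hex := h.unbounded k
  set e := Nat.find hex with he
  have h1 : k ≤ (s e).k := Nat.find_spec hex
  have h2 : E < e := by
    by_contra hc
    exact absurd (h1.trans (h.mono (not_lt.1 hc))) (not_le.2 hk)
  obtain ⟨d, hd⟩ : ∃ d, e = d + 1 := ⟨e - 1, by omega⟩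
  have h3 : ¬ k ≤ (s d).k := Nat.find_min hex (by omega)
  refine ⟨d, by omega, ?_⟩
  rw [hd] at h1
  rcases (h.trans d).k with h4 | h4 <;> omega

theorem parent_of_generation (h : Trajectory D P Qs C β r₀ s X I R M) {e : ℕ}
    (hk : (s (e + 1)).k = (s e).k + 1) : I ((s e).k + 1) = (s (e + 1)).inc := by
  rw [← (h.trans e).parent_new hk]
  exact (h.parent (e + 1) _ hk.ge).symm

theorem inc_mono (h : Trajectory D P Qs C β r₀ s X I R M) {e e' i : ℕ} (hle : e ≤ e')
    (hi : (s e).inc = some i) :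
    ∃ i', (s e').inc = some i' ∧ (i' = i ∨ D.Q (X i') < D.Q (X i)) := by
  induction e', hle using Nat.le_induction with
  | base => exact ⟨i, hi, .inl rfl⟩
  | succ e' _ ih =>
    obtain ⟨i', hi', hc⟩ := ih
    rcases (h.trans e').inc with h1 | ⟨q, hq, h1, h2⟩
    · exact ⟨i', h1.trans hi', hc⟩
    · refine ⟨q, h1, .inr ?_⟩
      have h3 := h2 i' hi'
      rw [h.x e' q hq, h.x e' i' ((h.core e').inc_le i' hi')] at h3
      rcases hc with rfl | hc
      · exact h3
      · exact h3.trans hc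

theorem inc_mono_le (h : Trajectory D P Qs C β r₀ s X I R M) {e e' i : ℕ} (hle : e ≤ e')
    (hi : (s e).inc = some i) : ∃ i', (s e').inc = some i' ∧ D.Q (X i') ≤ D.Q (X i) := by
  obtain ⟨i', h1, h2⟩ := h.inc_mono hle hi
  refine ⟨i', h1, ?_⟩
  rcases h2 with rfl | h2
  · exact le_rfl
  · exact h2.le

/-- The iterate x^0 has no parent, so once it is fully evaluated its verdict can only refer to an
existing incumbent. -/
theorem exists_inc (h : Trajectory D P Qs C β r₀ s X I R M) : ∃ e i, (s e).inc = some i := by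
  obtain ⟨e, -, he⟩ := h.done 0
  rcases (h.tasks e).judged 0 (Nat.zero_le _) (he e le_rfl) with ⟨i, hi, -⟩ | ⟨p, hp, -⟩
  · exact ⟨e, i, hi⟩
  · rw [h.parent e 0 (Nat.zero_le _), h.root] at hp
    simp at hp

theorem inc_feasible (h : Trajectory D P Qs C β r₀ s X I R M) {e i : ℕ}
    (hi : (s e).inc = some i) : X i ∈ D.feasible := by
  have hik := (h.core e).inc_le i hi
  rw [← h.x e i hik]
  exact (h.core e).x_feas i hik

/-- Predicted decreases stay bounded away from zero as long as the optimality gap of the incumbent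
does. -/
theorem gap_ge (h : Trajectory D P Qs C β r₀ s X I R M) (hD : D.Regular Qs C β) {ε : ℝ}
    (hε : ∀ e i, (s e).inc = some i → ε ≤ D.Q (X i) - Qs) {k i : ℕ} (hk : I k = some i) :
    min ε (min r₀ (ε / β) / C) ≤ D.Q (X i) - M k := by
  obtain ⟨e, he⟩ := h.unbounded k
  have hp : (s e).parent k = some i := (h.parent e k he).trans hk
  have hik : i ≤ (s e).k := ((h.core e).parent_lt k he i hp).le.trans he
  obtain ⟨i', hi', hle⟩ := (h.core e).parent_inc k he i hp
  rw [h.x e i hik, h.x e i' ((h.core e).inc_le i' hi')] at hle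
  have hδ : ε ≤ D.Q (X i) - Qs := (hε e i' hi').trans (by linarith)
  have h1 := (h.core e).gap k he i hp
  have h2 := (h.core e).radius_ge k he i hp
  rw [h.x e i hik, h.Δ e k he, h.mval e k he] at h1
  rw [h.x e i hik, h.Δ e k he] at h2
  refine le_trans (min_le_min hδ ?_) h1
  have hβ := hD.β_pos
  have hC := hD.C_pos
  gcongr
  refine le_trans ?_ h2
  gcongr

/-- If the incumbent takes only finitely many values, then it is eventually constant. -/
theorem inc_eventually_const (h : Trajectory D P Qs C β r₀ s X I R M) {E K : ℕ}
    (hfin : ∀ e, E ≤ e → ∃ i ≤ K, (s e).inc = some i) :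
    ∃ E' i, ∀ e, E' ≤ e → (s e).inc = some i := by
  -- Some index recurs infinitely often; a replaced incumbent is strictly worse than all later ones
  -- and could not return.
  have hfreq : ∃ i, ∃ᶠ e in Filter.atTop, (s e).inc = some i := by
    by_contra hc
    push Not at hc
    have hall : ∀ᶠ e in Filter.atTop, ∀ i ∈ Finset.range (K + 1), ¬ (s e).inc = some i :=
      (Filter.eventually_all_finset _).2 fun i _ => hc i
    obtain ⟨e, h1, h2⟩ := (hall.and (Filter.eventually_ge_atTop E)).exists
    obtain ⟨i, hi, hi'⟩ := hfin e h2
    exact h1 i (Finset.mem_range.2 (by omega)) hi'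
  obtain ⟨i, hi⟩ := hfreq
  obtain ⟨E', hE'⟩ := hi.exists
  refine ⟨E', i, fun e he => ?_⟩
  obtain ⟨i', h1, h2⟩ := h.inc_mono he hE'
  rcases h2 with rfl | h2
  · exact h1
  · obtain ⟨e', h3, h4⟩ := (hi.and_eventually (Filter.eventually_ge_atTop e)).exists
    obtain ⟨i'', h5, h6⟩ := h.inc_mono_le h4 h1
    obtain rfl : i = i'' := by rw [h3] at h5; simpa using h5
    exact absurd h6 (not_le.2 h2)

/-- If the optimality gap of the incumbents stays away from zero, then the incumbent is eventually
constant. -/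
theorem inc_eventually_const_of_gap (h : Trajectory D P Qs C β r₀ s X I R M)
    (hD : D.Regular Qs C β) (hξ : 0 < P.ξ) {g : ℝ} (hg : 0 < g)
    (hgap : ∀ k i, I k = some i → g ≤ D.Q (X i) - M k) :
    ∃ E i, ∀ e, E ≤ e → (s e).inc = some i := by
  let F : Set ℝ := {v | ∃ e i, (s e).inc = some i ∧ v = D.Q (X i)}
  obtain ⟨e₀, i₀, h₀⟩ := h.exists_inc
  have hne : F.Nonempty := ⟨_, e₀, i₀, h₀, rfl⟩
  have hbd : BddBelow F := ⟨Qs, by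
    rintro v ⟨e, i, hi, rfl⟩
    exact hD.lower _ (h.inc_feasible hi)⟩
  obtain ⟨v, ⟨E, i₁, hi₁, rfl⟩, hlt⟩ :=
    exists_lt_of_csInf_lt hne (lt_add_of_pos_right (sInf F) (mul_pos hξ hg))
  -- An iterate generated after E has a parent of value below inf F + ξg, so its acceptance would
  -- undercut the infimum. Only the finitely many iterates known at E, whose parents may be older,
  -- can still be incumbents.
  refine h.inc_eventually_const (E := E) (K := (s E).k) fun e he => ?_
  obtain ⟨q, hq, -⟩ := h.inc_mono_le he hi₁
  refine ⟨q, ?_, hq⟩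
  by_contra hc
  obtain ⟨e', he', h1, h2⟩ := h.exists_generation (not_le.1 hc)
  have hp : I q = (s (e' + 1)).inc := by
    rw [← h1]
    exact h.parent_of_generation (by omega)
  obtain ⟨i, hi, hle⟩ := h.inc_mono_le (he'.trans (Nat.le_succ e')) hi₁
  have hIq : I q = some i := hp.trans hi
  have hqk := (h.core e).inc_le q hq
  have hpe := (h.parent e q hqk).trans hIq
  have hacc := (h.core e).accepted q i hq hpe
  rw [h.x e q hqk, h.x e i (((h.core e).parent_lt q hqk i hpe).le.trans hqk), h.mval e q hqk] at hacc
  have h3 := mul_le_mul_of_nonneg_left (hgap q i hIq) hξ.le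
  have h4 : sInf F ≤ D.Q (X q) := csInf_le hbd ⟨e, q, hq, rfl⟩
  linarith

/-- With an incumbent that no longer changes, cuts generated late enough are never deleted. -/
theorem hasCut (h : Trajectory D P Qs C β r₀ s X I R M) {E i l : ℕ}
    (hinc : ∀ e, E ≤ e → (s e).inc = some i) (hl : (s E).k < l)
    (hI : ∀ k, (s E).k < k → I k = some i)
    (hη : ∀ k, l ≤ k → P.η * (D.Q (X i) - M l) < D.Q (X i) - M k) (e : ℕ) :
    l ≤ (s e).k → ∀ j, HasCut (s e) l j := by
  induction e with
  | zero => intro hle; rw [h.zero] at hle; omega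
  | succ e ih =>
    intro hle j
    by_cases hle' : l ≤ (s e).k
    · have he : E ≤ e := by
        by_contra hc
        exact absurd (hle'.trans (h.mono (not_le.1 hc).le)) (not_le.2 hl)
      have hpk : (s e).parent (s e).k = some i :=
        (h.parent e _ le_rfl).trans (hI _ (hl.trans_le hle'))
      refine (h.trans e).keep i (hinc e he) (hinc (e + 1) (by omega)) hpk l hle'
        ((h.parent e l hle').trans (hI l hl)) ?_ j (ih hle' j) (h.running _)
      rw [h.x e i ((h.core e).inc_le i (hinc e he)), h.mval e l hle', h.mval e _ le_rfl]
      exact hη _ hle'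
    · rcases (h.trans e).k with h1 | h1
      · omega
      · obtain rfl : l = (s e).k + 1 := by omega
        exact .inl ((h.trans e).pending_new (h.running _) h1 j)

/-- The model at a later iterate takes an evaluated iterate with retained cuts into account. -/
theorem mval_ge {L B : ℝ} (h : Trajectory D P Qs C β r₀ s X I R M)
    (hL : ∀ j x x', D.clusterQ j x' ≤ D.clusterQ j x + L * ‖x' - x‖)
    (hB : B = (∑ k, |D.c k|) + ∑ _j : Fin T, L)
    {e l k : ℕ} (hk : (s e).k + 1 = k) (hk' : (s (e + 1)).k = k)
    (hcut : ∀ j, ∃ κ ∈ (s (e + 1)).cuts, κ.origin = some l ∧ κ.cluster = j) :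
    D.Q (X l) - B * ‖X k - X l‖ ≤ M k := by
  subst hk
  obtain ⟨θ, hθ, hM⟩ := (h.trans e).sol hk'
  rw [h.mval (e + 1) _ hk'.ge, h.x (e + 1) _ hk'.ge] at hM
  rw [h.x (e + 1) _ hk'.ge] at hθ
  set k := (s e).k + 1
  have hθj : ∀ j, D.clusterQ j (X l) - L * ‖X k - X l‖ ≤ θ j := by
    intro j
    obtain ⟨κ, hκ, ho, rfl⟩ := hcut j
    obtain ⟨hlk, htouch⟩ := (h.core (e + 1)).cuts_touch κ hκ l ho
    rw [h.x (e + 1) l hlk] at htouch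
    exact (Cut.val_ge hL ((h.core (e + 1)).cuts_minorant κ hκ) htouch (X k)).trans (hθ κ hκ)
  have hsum : ∑ j, D.clusterQ j (X l) - (∑ _j : Fin T, L) * ‖X k - X l‖ ≤ ∑ j, θ j := by
    rw [Finset.sum_mul, ← Finset.sum_sub_distrib]
    exact Finset.sum_le_sum fun j _ => hθj j
  have hc : D.c ⬝ᵥ X l - (∑ k, |D.c k|) * ‖X k - X l‖ ≤ D.c ⬝ᵥ X k := by
    have := (neg_le_abs _).trans (abs_dotProduct_le D.c (X k - X l))
    rw [dotProduct_sub] at this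
    linarith
  rw [hM, TwoStageLP.Q_eq_sum_clusterQ, subObj, hB]
  linarith

/-- If the incumbent is eventually constant, then predicted decreases are not bounded away from
zero. -/
theorem not_eventually_const (h : Trajectory D P Qs C β r₀ s X I R M) (hP : P.Admissible D)
    {L : ℝ} (hL0 : 0 ≤ L)
    (hL : ∀ j x x', D.clusterQ j x' ≤ D.clusterQ j x + L * ‖x' - x‖) {g : ℝ} (hg : 0 < g)
    (hgap : ∀ k i, I k = some i → g ≤ D.Q (X i) - M k) {E i : ℕ}
    (hinc : ∀ e, E ≤ e → (s e).inc = some i) : False := by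
  have hI : ∀ k, (s E).k < k → I k = some i := by
    intro k hk
    obtain ⟨e, he, h1, h2⟩ := h.exists_generation hk
    rw [← h1, h.parent_of_generation (by omega)]
    exact hinc _ (by omega)
  have hstep : ∀ k, (s E).k < k → M k ≤ M (k + 1) := by
    intro k hk
    obtain ⟨e, he, h1, h2⟩ := h.exists_generation (hk.trans (Nat.lt_succ_self k))
    obtain rfl : k = (s e).k := by omega
    have := (h.trans e).mono i (hinc e he) (hinc (e + 1) (by omega))
      ((h.parent e _ le_rfl).trans (hI _ hk)) h2
    rwa [h.mval e _ le_rfl, h.mval (e + 1) _ h2.ge] at this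
  have hmono : ∀ l k, (s E).k < l → l ≤ k → M l ≤ M k := by
    intro l k hl hlk
    induction k, hlk using Nat.le_induction with
    | base => exact le_rfl
    | succ k hk ih => exact ih.trans (hstep k (hl.trans_le hk))
  let F : Set ℝ := {v | ∃ k, (s E).k < k ∧ v = D.Q (X i) - M k}
  have hne : F.Nonempty := ⟨_, (s E).k + 1, Nat.lt_succ_self _, rfl⟩
  have hlow : ∀ v ∈ F, g ≤ v := by
    rintro v ⟨k, hk, rfl⟩
    exact hgap k i (hI k hk)
  set G := sInf F with hG
  have hG0 : 0 < G := hg.trans_le (le_csInf hne hlow)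
  have hGle : ∀ k, (s E).k < k → G ≤ D.Q (X i) - M k := fun k hk =>
    csInf_le ⟨g, hlow⟩ ⟨k, hk, rfl⟩
  obtain ⟨hη0, hη1⟩ := hP.η_mem
  obtain ⟨hξ0, hξ1⟩ := hP.ξ_mem
  -- The margin G(1 - η) gives η(Q^I - M l) ≤ G(1 - (1 - η)²) < G for l ≥ K, so cuts generated there
  -- stay protected; the margin G/2 gives ξ(Q^I - M l) ≤ 3G/4.
  obtain ⟨v, ⟨K, hK, rfl⟩, hlt⟩ := exists_lt_of_csInf_lt hne
    (lt_add_of_pos_right (sInf F) (lt_min (mul_pos hG0 (sub_pos.2 hη1)) (half_pos hG0)))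
  rw [← hG] at hlt
  have hlt1 : D.Q (X i) - M K < G + G * (1 - P.η) := hlt.trans_le (by gcongr; exact min_le_left _ _)
  have hlt2 : D.Q (X i) - M K < G + G / 2 := hlt.trans_le (by gcongr; exact min_le_right _ _)
  have hcuts : ∀ l, K ≤ l → ∀ e, l ≤ (s e).k → ∀ j, HasCut (s e) l j := by
    intro l hl
    refine h.hasCut hinc (hK.trans_le hl) hI fun k hk => ?_
    have h1 := hmono K l hK hl
    have h2 := hGle k (hK.trans_le (hl.trans hk))
    have h3 : P.η * (D.Q (X i) - M l) ≤ P.η * (G + G * (1 - P.η)) :=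
      mul_le_mul_of_nonneg_left (by linarith) hη0
    have h4 : P.η * (G + G * (1 - P.η)) = G - G * (1 - P.η) ^ 2 := by ring
    have h5 : 0 < G * (1 - P.η) ^ 2 := mul_pos hG0 (pow_pos (sub_pos.2 hη1) 2)
    linarith
  set B := (∑ k, |D.c k|) + ∑ _j : Fin T, L with hB
  have hB0 : 0 ≤ B := by positivity
  -- Once x^l is evaluated and rejected, G ≤ Q^I - M k ≤ ξ(Q^I - M l) + B‖X k - X l‖ for later k,
  -- and the first term is at most 3G/4.
  have hsep : ∀ l, K ≤ l → ∃ K', ∀ k, K' < k → G / 4 ≤ B * ‖X k - X l‖ := by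
    intro l hl
    obtain ⟨e₀, he₀, hdone⟩ := h.done l
    set e₁ := max e₀ E with he₁
    have hle₁ : l ≤ (s e₁).k := he₀.trans (h.mono (le_max_left _ _))
    have hQl : D.Q (X i) - P.ξ * (D.Q (X i) - M l) ≤ D.Q (X l) := by
      have hpos : 0 ≤ P.ξ * (D.Q (X i) - M l) :=
        mul_nonneg hξ0.le (hG0.le.trans (hGle l (hK.trans_le hl)))
      have hi1 := hinc e₁ (le_max_right _ _)
      have hik := (h.core e₁).inc_le i hi1
      rcases (h.tasks e₁).judged l hle₁ (hdone e₁ (le_max_left _ _)) with ⟨i', hi', hle⟩ | ⟨p, hp, hlt⟩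
      · obtain rfl : i = i' := by rw [hi1] at hi'; simpa using hi'
        rw [h.x e₁ i hik, h.x e₁ l hle₁] at hle
        linarith
      · rw [h.parent e₁ l hle₁, hI l (hK.trans_le hl)] at hp
        obtain rfl : i = p := by simpa using hp
        rw [h.x e₁ i hik, h.x e₁ l hle₁, h.mval e₁ l hle₁] at hlt
        exact hlt.le
    refine ⟨(s e₁).k, fun k hk => ?_⟩
    obtain ⟨e, he, h1, h2⟩ := h.exists_generation hk
    have he' : e₁ ≤ e + 1 := by omega
    have hM := h.mval_ge hL hB h1 h2 fun j =>
      (hcuts l hl (e + 1) (hle₁.trans (h.mono he')) j).resolve_left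
        (hdone (e + 1) ((le_max_left _ _).trans he') j)
    have h3 := hGle k (hK.trans_le (hl.trans (hle₁.trans hk.le)))
    have h4 := hmono K l hK hl
    have h5 : P.ξ * (D.Q (X i) - M l) ≤ 1 / 2 * (G + G / 2) :=
      mul_le_mul hξ1.le (by linarith) (hG0.le.trans (hGle l (hK.trans_le hl))) (by norm_num)
    linarith
  have hball : ∀ m, X (K + m) ∈ Metric.closedBall (X i) P.Δhi := by
    intro m
    obtain ⟨e, he⟩ := h.unbounded (K + m)
    have hp := (h.parent e _ he).trans (hI (K + m) (by omega))
    have h1 := ((h.core e).trust _ he i hp).trans ((h.core e).radius_le _ he)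
    rw [h.x e _ he, h.x e i (((h.core e).parent_lt _ he i hp).le.trans he)] at h1
    rwa [Metric.mem_closedBall, dist_eq_norm]
  obtain ⟨a, -, φ, hφ, hlim⟩ := (isCompact_closedBall (X i) P.Δhi).tendsto_subseq hball
  have hcauchy := hlim.cauchySeq
  -- The denominator B + 1 allows for B = 0.
  have hε : 0 < G / 4 / (B + 1) := by positivity
  obtain ⟨m, hm⟩ := Metric.cauchySeq_iff'.1 hcauchy _ hε
  obtain ⟨K', hK'⟩ := hsep (K + φ m) (Nat.le_add_right _ _)
  have h1 := hm (max m (K' + 1)) (le_max_left _ _)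
  have h2 := hK' (K + φ (max m (K' + 1))) (by
    have := hφ.id_le (max m (K' + 1))
    have h3 := le_max_right m (K' + 1)
    simp only [id] at this
    omega)
  rw [dist_eq_norm, lt_div_iff₀ (by positivity)] at h1
  simp only [Function.comp] at h1
  have := norm_nonneg (X (K + φ (max m (K' + 1))) - X (K + φ m))
  linarith

/-- The objective values of the incumbents converge to the optimal value. -/
theorem exists_inc_lt (h : Trajectory D P Qs C β r₀ s X I R M) (hP : P.Admissible D)
    (hD : D.Regular Qs C β) (hr₀ : 0 < r₀) {L : ℝ} (hL0 : 0 ≤ L)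
    (hL : ∀ j x x', D.clusterQ j x' ≤ D.clusterQ j x + L * ‖x' - x‖) {ε : ℝ} (hε : 0 < ε) :
    ∃ e i, (s e).inc = some i ∧ D.Q (X i) - Qs < ε := by
  by_contra hc
  push Not at hc
  have hβ := hD.β_pos
  have hC := hD.C_pos
  have hg : 0 < min ε (min r₀ (ε / β) / C) :=
    lt_min hε (div_pos (lt_min hr₀ (by positivity)) hC)
  have hgap : ∀ k i, I k = some i → min ε (min r₀ (ε / β) / C) ≤ D.Q (X i) - M k :=
    fun k i hk => h.gap_ge hD hc hk
  obtain ⟨E, i, hE⟩ := h.inc_eventually_const_of_gap hD hP.ξ_mem.1 hg hgap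
  exact h.not_eventually_const hP hL0 hL hg hgap hE

theorem eventually_parent (h : Trajectory D P Qs C β r₀ s X I R M) (hP : P.Admissible D)
    (hD : D.Regular Qs C β) (hr₀ : 0 < r₀) {L : ℝ} (hL0 : 0 ≤ L)
    (hL : ∀ j x x', D.clusterQ j x' ≤ D.clusterQ j x + L * ‖x' - x‖) {ε : ℝ} (hε : 0 < ε) :
    ∀ᶠ k in Filter.atTop, ∃ i, I k = some i ∧ X i ∈ D.feasible ∧ D.Q (X i) - Qs < ε := by
  obtain ⟨E, i₀, hi₀, hlt⟩ := h.exists_inc_lt hP hD hr₀ hL0 hL hε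
  filter_upwards [Filter.eventually_gt_atTop (s E).k] with k hk
  obtain ⟨e, he, h1, h2⟩ := h.exists_generation hk
  obtain ⟨i, hi, hle⟩ := h.inc_mono_le (he.trans (Nat.le_succ e)) hi₀
  refine ⟨i, ?_, h.inc_feasible hi, by linarith⟩
  rw [← h1, h.parent_of_generation (by omega)]
  exact hi

end Trajectory

end ATR

/-! ### Assembly of the theorem. -/

theorem TwoStageLP.exists_regular {n r n₂ r₂ N T : ℕ} {D : TwoStageLP n r n₂ r₂ N T}
    (hrec : D.CompleteRecourse) (hbdd : D.RecourseBounded) {xs : Fin n → ℝ}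
    (hxs : xs ∈ D.solutions) : ∃ C β, D.Regular (D.Q xs) C β := by
  obtain ⟨C, hC, hsharp⟩ := exists_weak_sharp hrec hbdd hxs
  obtain ⟨β, hβ, hlip⟩ := Q_lipschitz hrec hbdd
  refine ⟨C, β, hC, hβ, hxs.2, fun x hx => ?_, hlip, Q_convex hrec hbdd⟩
  obtain ⟨s, hs, hd⟩ := hsharp x hx
  exact ⟨s, hs.1, le_antisymm (hs.2 xs hxs.1) (hxs.2 s hs.1), hd⟩

/-- Probabilities that sum to 1 require a scenario, and its cluster exists. -/
theorem TwoStageLP.clusters_pos {n r n₂ r₂ N T : ℕ} (D : TwoStageLP n r n₂ r₂ N T) : 0 < T := by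
  rcases Nat.eq_zero_or_pos N with rfl | hN
  · have := D.p_sum
    simp at this
  · exact (D.cluster ⟨0, hN⟩).pos

theorem mainTheorem5 {n r n₂ r₂ N T : ℕ} (D : TwoStageLP n r n₂ r₂ N T)
    (hrec : D.CompleteRecourse) (hbdd : D.RecourseBounded) (hS : D.solutions.Nonempty)
    (P : ATR.Params n T) (hP : P.Admissible D) (htol : P.tol = 0)
    (s : ℕ → ATR.State n T) (hs : ATR.IsRun D P s) :
    -- the algorithm stops, at an incumbent that is a solution
    (∃ e i, (s e).stopped ∧ (s e).inc = some i ∧ (s e).x i ∈ D.solutions) ∨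
    -- or it generates infinitely many iterates `x^k`, with parent incumbents `I k` and `z k = x^{I k}`
    ((∀ e, ¬ (s e).stopped) ∧ (∀ k, ∃ e, k ≤ (s e).k) ∧
      ∃ (I : ℕ → Option ℕ) (z : ℕ → Fin n → ℝ),
        (∀ e k, k ≤ (s e).k → (s e).parent k = I k ∧ (s e).point (I k) = z k) ∧
        (∀ᶠ k in Filter.atTop, I k ≠ none) ∧
        (∃ proj : (Fin n → ℝ) → (Fin n → ℝ),
          (∀ x, IsEuclideanProjection D.solutions x (proj x)) ∧
          Filter.Tendsto (fun k => ‖z k - proj (z k)‖) Filter.atTop (nhds 0)) ∧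
        -- and if the incumbent changes only finitely often, then the last one is a solution
        (∀ i, (∀ᶠ k in Filter.atTop, I k = some i) →
          ∀ᶠ k in Filter.atTop, z k ∈ D.solutions)) := by
  obtain ⟨xs, hxs⟩ := hS
  have hT := D.clusters_pos
  obtain ⟨C, β, hD⟩ := TwoStageLP.exists_regular hrec hbdd hxs
  obtain ⟨L, hL0, hL⟩ := TwoStageLP.clusterQ_lipschitz hrec hbdd
  have hβ := hD.β_pos
  have hC := hD.C_pos
  -- This r₀ lies below the initial radius, so that the radius bound holds at the start, and below
  -- 1/(βC), so that reductions preserve it.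
  have hr₁ : min P.Δinit (1 / (β * C)) ≤ P.Δinit := min_le_left _ _
  have hr₂ : min P.Δinit (1 / (β * C)) ≤ 1 / (β * C) := min_le_right _ _
  have hr₀ : 0 < min P.Δinit (1 / (β * C)) := lt_min hP.Δinit_mem.1 (by positivity)
  by_cases hhalt : ∃ e, (s e).stopped
  · obtain ⟨e, he⟩ := hhalt
    left
    obtain ⟨hcore, -, -, hst⟩ := hs.invariant hT hD hP hr₁ hr₂ e
    obtain ⟨i, hi, hf, hle⟩ := hcore.optimal_of_convTest hD htol (hst he).1 (hst he).2
    exact ⟨e, i, he, hi, hf, fun y hy => hle.trans (hxs.2 y hy)⟩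
  right
  push Not at hhalt
  obtain ⟨X, I, R, M, h⟩ := hs.exists_trajectory hT hD hP hr₁ hr₂ hhalt
  let z : ℕ → Fin n → ℝ := fun k => match I k with
    | none => X 0
    | some i => X i
  have hz : ∀ k i, I k = some i → z k = X i := fun k i hk => by simp only [z, hk]
  have hev : ∀ ε : ℝ, 0 < ε → ∀ᶠ k in Filter.atTop,
      ∃ i, I k = some i ∧ X i ∈ D.feasible ∧ D.Q (X i) - D.Q xs < ε := fun ε hε =>
    h.eventually_parent hP hD hr₀ hL0 hL hε
  refine ⟨hhalt, h.unbounded, I, z, fun e k hk => ⟨h.parent e k hk, ?_⟩, ?_, ?_, ?_⟩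
  · rcases hI : I k with _ | i
    · have : z k = X 0 := by simp only [z, hI]
      rw [this]
      exact h.x e 0 (Nat.zero_le _)
    · rw [hz k i hI]
      exact h.x e i (((h.core e).parent_lt k hk i ((h.parent e k hk).trans hI)).le.trans hk)
  · filter_upwards [hev 1 one_pos] with k ⟨i, hi, _⟩
    rw [hi]
    simp
  · choose proj hproj using exists_isEuclideanProjection
      (TwoStageLP.solutions_isClosed hrec hbdd) ⟨xs, hxs⟩
    refine ⟨proj, hproj, ?_⟩
    -- Weak sharpness is taken again in the form that names a point of `solutions`, which bounds the
    -- distance to the projection.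
    obtain ⟨C', hC', hsharp⟩ := TwoStageLP.exists_weak_sharp hrec hbdd hxs
    rw [Metric.tendsto_nhds]
    intro ε hε
    have hpos : 0 < ((n : ℝ) + 1) * C' := by positivity
    filter_upwards [hev (ε / (((n : ℝ) + 1) * C')) (by positivity)] with k ⟨i, hi, hf, hlt⟩
    rw [hz k i hi, dist_zero_right, norm_norm]
    obtain ⟨y, hy, hd⟩ := hsharp (X i) hf
    rw [lt_div_iff₀ hpos] at hlt
    calc ‖X i - proj (X i)‖ ≤ (n + 1) * ‖y - X i‖ := (hproj (X i)).norm_sub_le hy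
      _ ≤ (n + 1) * (C' * (D.Q (X i) - D.Q xs)) := by gcongr
      _ = (D.Q (X i) - D.Q xs) * ((n + 1) * C') := by ring
      _ < ε := hlt
  · intro i hi
    have hXi : X i ∈ D.solutions := by
      have hle : ∀ ε : ℝ, 0 < ε → X i ∈ D.feasible ∧ D.Q (X i) - D.Q xs < ε := by
        intro ε hε
        -- The last incumbent is the parent at all large k, hence its gap is below every ε.
        obtain ⟨k, ⟨i', hi', hf, hlt⟩, hk⟩ := ((hev ε hε).and hi).exists
        obtain rfl : i = i' := by rw [hk] at hi'; simpa using hi'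
        exact ⟨hf, hlt⟩
      refine ⟨(hle 1 one_pos).1, fun y hy => le_trans ?_ (hxs.2 y hy)⟩
      refine le_of_forall_pos_le_add fun ε hε => ?_
      linarith [(hle ε hε).2]
    filter_upwards [hi] with k hk
    rwa [hz k i hk]
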